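/- Let $F$ be an algebraically closed field of characteristic $p>0$, let $d,e>1$ be integers with $d\equiv 0$ or $1 \pmod p$ and $p\mid e\le d$, and let $c\in\mathbb P^1(F)$. Let $\mathrm{Rat}_d\subset\mathbb P^{2d+1}(F)$ be the Zariski open set of rational functions $\phi=f/g$ of degree $d$ (coordinates: the coefficients of $f$ and $g$; condition: the degree-$(d,d)$ resultant of $f,g$ is nonzero). Let $U_{d,e}^{(c)}\subset \mathrm{Rat}_d$ be the subspace, with the Zariski topology, of those $\phi$ whose ramification index is exactly $e$ at $c$ and $1$ at every other point of $\mathbb P^1(F)$; here the ramification index of $\phi$ at $x$ is the multiplicity of $x$ as a solution of $\phi(z)=\phi(x)$. Let $\mathrm{SL}_2(F)$ act on it by postcomposition, $\phi\mapsto\sigma\circ\phi$, and give the orbit space $\mathrm{SL}_2\backslash U_{d,e}^{(c)}$ the quotient topology. Then the (Krull) dimension of this space is $$\dim\left(\mathrm{SL}_2\backslash U_{d,e}^{(c)}\right)=\begin{cases}(2d-e)/p & \text{if } p\mid d,\\ 1+(2d-2-e)/p & \text{if } p\mid d-1.\end{cases}$$ In particular, $U_{d,e}^{(c)}$ is nonempty.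 -/

import Mathlib

open scoped LinearAlgebra.Projectivization MatrixGroups

noncomputable section

namespace Unicritical

variable (F : Type*) [Field F]

/-- The projective space of dimension `2d + 1` whose points are the classes, up to a nonzero
scalar, of pairs `(f, g) ≠ (0, 0)` of polynomials of formal degree `d`. The pair is stored as the
`2 × (d+1)` matrix of its coefficients: row `0` holds `f`, row `1` holds `g`, and column `j` holds
the coefficients of `z ^ j`. -/
abbrev CoeffSpace (d : ℕ) : Type _ := ℙ F (Matrix (Fin 2) (Fin (d + 1)) F)

variable {F}

/-- The polynomial whose coefficients are the entries of row `i` of `M`. -/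
def rowPoly {d : ℕ} (M : Matrix (Fin 2) (Fin (d + 1)) F) (i : Fin 2) : Polynomial F :=
  ∑ j : Fin (d + 1), Polynomial.monomial (j : ℕ) (M i j)

/-- The Zariski topology on projective space over `F`, generated by the (basic) open sets
`{x | G(x) ≠ 0}` with `G` a homogeneous polynomial in the homogeneous coordinates. Since `G` is
homogeneous, its nonvanishing does not depend on the choice of homogeneous coordinates. -/
instance zariskiTopology (d : ℕ) : TopologicalSpace (CoeffSpace F d) :=
  TopologicalSpace.generateFrom
    {U | ∃ (n : ℕ) (G : MvPolynomial (Fin 2 × Fin (d + 1)) F), G.IsHomogeneous n ∧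
      U = {x : CoeffSpace F d | MvPolynomial.eval (fun k => x.rep k.1 k.2) G ≠ 0}}

/-- `x` is (the coefficient vector of) a rational function of degree `d`: the degree-`(d, d)`
resultant of numerator and denominator does not vanish. The condition is homogeneous in the
coordinates. -/
def IsRat {d : ℕ} (x : CoeffSpace F d) : Prop :=
  Polynomial.resultant (rowPoly x.rep 0) (rowPoly x.rep 1) d d ≠ 0

/-- The coefficient matrix of `z ↦ φ(1/z)`, where `M` is the coefficient matrix of `φ`. -/
def invSource {d : ℕ} (M : Matrix (Fin 2) (Fin (d + 1)) F) : Matrix (Fin 2) (Fin (d + 1)) F :=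
  fun i j => M i j.rev

/-- The ramification index of `φ = f / g` at a finite point `a`: the order to which `φ` takes the
value `φ(a) = (f(a) : g(a))` at `a`, that is, the order of vanishing at `a` of
`g(a) f(z) - f(a) g(z)`. -/
def ramIndexFinite {d : ℕ} (M : Matrix (Fin 2) (Fin (d + 1)) F) (a : F) : ℕ :=
  (Polynomial.C ((rowPoly M 1).eval a) * rowPoly M 0
    - Polynomial.C ((rowPoly M 0).eval a) * rowPoly M 1).rootMultiplicity a

/-- The ramification index of a rational function at a point of the projective line
`F ∪ {∞}`; at `∞` it is that of `z ↦ φ(1/z)` at `0`. -/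
def ramIndex {d : ℕ} (M : Matrix (Fin 2) (Fin (d + 1)) F) : OnePoint F → ℕ
  | OnePoint.infty => ramIndexFinite (invSource M) 0
  | OnePoint.some a => ramIndexFinite M a

/-- The space of rational functions of degree `d` that are ramified at `c` with index `e` and
unramified at every other point, as a subset of the projective space of coefficients. -/
def ramLocus (d e : ℕ) (c : OnePoint F) : Set (CoeffSpace F d) :=
  {x | IsRat x ∧ ramIndex x.rep c = e ∧ ∀ y : OnePoint F, y ≠ c → ramIndex x.rep y = 1}

theorem sl_mul_injective {d : ℕ} (σ : SL(2, F)) :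
    Function.Injective (mulLeftLinearMap (Fin (d + 1)) F (σ : Matrix (Fin 2) (Fin 2) F)) := by
  intro A B h
  have h' : (σ : Matrix (Fin 2) (Fin 2) F) * A = (σ : Matrix (Fin 2) (Fin 2) F) * B := h
  have h2 := congrArg (fun C => ((σ⁻¹ : SL(2, F)) : Matrix (Fin 2) (Fin 2) F) * C) h'
  simpa only [← Matrix.mul_assoc, ← Matrix.SpecialLinearGroup.coe_mul, inv_mul_cancel,
    Matrix.SpecialLinearGroup.coe_one, Matrix.one_mul] using h2

/-- Postcomposition with the fractional linear transformation `σ`: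
`(f, g) ↦ (σ₀₀ f + σ₀₁ g, σ₁₀ f + σ₁₁ g)`, i.e. left multiplication of the coefficient matrix. -/
def postcomp {d : ℕ} (σ : SL(2, F)) : CoeffSpace F d → CoeffSpace F d :=
  Projectivization.map
    (mulLeftLinearMap (Fin (d + 1)) F (σ : Matrix (Fin 2) (Fin 2) F)) (sl_mul_injective σ)

theorem postcomp_one {d : ℕ} (x : CoeffSpace F d) : postcomp 1 x = x := by
  induction x using Projectivization.ind with
  | h v hv => simp [postcomp, Projectivization.map_mk]

theorem postcomp_mul {d : ℕ} (σ τ : SL(2, F)) (x : CoeffSpace F d) :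
    postcomp (σ * τ) x = postcomp σ (postcomp τ x) := by
  induction x using Projectivization.ind with
  | h v hv => simp [postcomp, Projectivization.map_mk]

/-- Two elements of the space are equivalent if they lie in the same orbit under
postcomposition with `SL₂(F)`. -/
def postcompSetoid (d e : ℕ) (c : OnePoint F) : Setoid (ramLocus d e c) where
  r x y := ∃ σ : SL(2, F), postcomp σ (x : CoeffSpace F d) = y
  iseqv :=
    { refl := fun x => ⟨1, postcomp_one _⟩
      symm := by
        rintro x y ⟨σ, h⟩
        exact ⟨σ⁻¹, by rw [← h, ← postcomp_mul, inv_mul_cancel, postcomp_one]⟩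
      trans := by
        rintro x y z ⟨σ, h⟩ ⟨τ, h'⟩
        exact ⟨τ * σ, by rw [postcomp_mul, h, h']⟩ }

/-- The space of postcomposition classes `SL₂ \ U`. -/
def PostcompClasses (d e : ℕ) (c : OnePoint F) : Type _ :=
  Quotient (postcompSetoid d e c)

/-- The orbit space carries the quotient of the Zariski (subspace) topology. -/
instance (d e : ℕ) (c : OnePoint F) : TopologicalSpace (PostcompClasses d e c) :=
  inferInstanceAs (TopologicalSpace (Quotient (postcompSetoid d e c)))

end Unicritical

end

/-! The orbit space is homeomorphic to a principal open subset of an affine space, and the dimension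
is the number of coordinates. The substitution `z ↦ c + 1/z` in the source commutes with
postcomposition and reduces everything to `c = ∞`.

Let `φ = f/g`. It is unramified at a finite point exactly when the Wronskian `f g' - f' g` does not
vanish there, so over an algebraically closed field the condition at all finite points says that the
Wronskian is a nonzero constant. Differentiating gives `f g'' = f'' g` with `f`, `g` coprime, hence
`f'' = g'' = 0` by degree. In characteristic `p` this means `f = z^ε P(z^p) + z^(1-ε) Q(z^p)` and `g
= z^ε P₁(z^p) + z^(1-ε) Q₁(z^p)`. The Wronskian is then `±(P Q₁ - Q P₁)(z^p)`, and what remains is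
that this determinant be a nonzero constant.

Write `d = p m + ε` with `ε ∈ {0, 1}` and `d - e = p n + ε`. Index `e` at `∞` says that a suitable
basis of the span of `f`, `g` has degrees `d` and `d - e`. The basis becomes unique when `P`, `P₁`
are monic of degrees `m`, `n` and `P` has no term of degree `n`. For coprime `P`, `P₁` and
determinant `-k`, Bézout gives `(Q, Q₁)` up to multiples of `(P, P₁)`. The bound `deg f ≤ d` leaves
no freedom for `ε = 0` and one scalar for `ε = 1`. The parameters number `(m - 1) + n + 1 + ε = m +
n + ε`, subject only to `k ≠ 0` and `Res(P, P₁) ≠ 0`.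

Both directions are continuous: the coordinates are ratios of `2 × 2` minors (`coords`), and the
normal form, once multiplied by the resultant, is polynomial in them (`normalMatrix`). They are
inverse by `coords_normalMatrix` and `exists_mul_eq_normalMatrix`, and `postcompClassesHomeomorph`
combines them. -/

namespace Unicritical

/-! ### Zariski topology and dimension of affine space -/

/-- The `F`-points of affine space with coordinates indexed by `ι`, carrying the Zariski
topology. -/
def AffinePoints (F ι : Type*) : Type _ := ι → F

namespace AffinePoints

variable {F : Type*} [Field F] {ι : Type*}

noncomputable instance : TopologicalSpace (AffinePoints F ι) :=
  TopologicalSpace.induced (MvPolynomial.pointToPoint (k := F) (K := F) (σ := ι)) inferInstance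

/-- Evaluation of a polynomial at a point of affine space. -/
noncomputable def eval (x : AffinePoints F ι) : MvPolynomial ι F →+* F :=
  MvPolynomial.eval (x : ι → F)

@[simp]
theorem eval_X (x : AffinePoints F ι) (j : ι) : x.eval (MvPolynomial.X j) = x j :=
  MvPolynomial.eval_X (f := (x : ι → F)) j

@[simp]
theorem eval_C (x : AffinePoints F ι) (r : F) : x.eval (MvPolynomial.C r) = r :=
  MvPolynomial.eval_C (f := (x : ι → F)) r

theorem preimage_basicOpen (G : MvPolynomial ι F) :
    MvPolynomial.pointToPoint (k := F) (K := F) (σ := ι) ⁻¹' (PrimeSpectrum.basicOpen G) =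
      {x : AffinePoints F ι | x.eval G ≠ 0} := by
  ext x
  simp only [Set.mem_preimage, SetLike.mem_coe, PrimeSpectrum.mem_basicOpen,
    MvPolynomial.pointToPoint, ne_eq]
  rw [MvPolynomial.mem_vanishingIdeal_singleton_iff, MvPolynomial.aeval_eq_eval]
  rfl

theorem isTopologicalBasis : TopologicalSpace.IsTopologicalBasis
    (Set.range fun G : MvPolynomial ι F => {x : AffinePoints F ι | x.eval G ≠ 0}) := by
  have h := PrimeSpectrum.isTopologicalBasis_basic_opens (R := MvPolynomial ι F)
  have h2 := h.induced (MvPolynomial.pointToPoint (k := F) (K := F) (σ := ι))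
  rw [← Set.range_comp] at h2
  refine (congrArg TopologicalSpace.IsTopologicalBasis ?_).mp h2
  exact congrArg Set.range (funext preimage_basicOpen)

theorem isOpen_ne (G : MvPolynomial ι F) : IsOpen {x : AffinePoints F ι | x.eval G ≠ 0} :=
  isTopologicalBasis.isOpen ⟨G, rfl⟩

theorem isClosed_eq (G : MvPolynomial ι F) : IsClosed {x : AffinePoints F ι | x.eval G = 0} := by
  rw [← isOpen_compl_iff]
  exact isOpen_ne G

theorem continuous_iff {Y : Type*} [TopologicalSpace Y] {f : Y → AffinePoints F ι} :
    Continuous f ↔ ∀ G : MvPolynomial ι F, IsOpen {y | (f y).eval G ≠ 0} := by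
  rw [isTopologicalBasis.continuous_iff]
  simp only [Set.forall_mem_range]
  rfl

theorem exists_eval_ne_zero [Infinite F] {G : MvPolynomial ι F} (hG : G ≠ 0) :
    ∃ x : AffinePoints F ι, x.eval G ≠ 0 := by
  by_contra! h
  exact hG (MvPolynomial.funext fun x => (h x).trans (map_zero _).symm)

instance [Infinite F] : IrreducibleSpace (AffinePoints F ι) where
  isPreirreducible_univ := by
    rintro u v hu hv ⟨x, -, hx⟩ ⟨y, -, hy⟩
    obtain ⟨_, ⟨G, rfl⟩, hxG, hGu⟩ := isTopologicalBasis.exists_subset_of_mem_open hx hu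
    obtain ⟨_, ⟨H, rfl⟩, hyH, hHv⟩ := isTopologicalBasis.exists_subset_of_mem_open hy hv
    have hG : G ≠ 0 := by rintro rfl; simp at hxG
    have hH : H ≠ 0 := by rintro rfl; simp at hyH
    obtain ⟨z, hz⟩ := exists_eval_ne_zero (mul_ne_zero hG hH)
    rw [map_mul] at hz
    exact ⟨z, trivial, hGu (left_ne_zero_of_mul hz), hHv (right_ne_zero_of_mul hz)⟩
  toNonempty := ⟨fun _ => 0⟩

theorem isInducing_pointToPoint : Topology.IsInducing
    fun x : AffinePoints F ι => MvPolynomial.pointToPoint (k := F) (K := F) (σ := ι) x := ⟨rfl⟩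

/-- The topology is induced from the prime spectrum of the polynomial ring, whose dimension over a
field is the number of variables. -/
theorem topologicalKrullDim_le [Finite ι] :
    topologicalKrullDim (AffinePoints F ι) ≤ Nat.card ι := by
  refine isInducing_pointToPoint.topologicalKrullDim_le.trans ?_
  rw [PrimeSpectrum.topologicalKrullDim_eq_ringKrullDim,
    MvPolynomial.ringKrullDim_of_isNoetherianRing, ringKrullDim_eq_zero_of_field]
  simp

/-- The coordinate subspace through `a` on which only the coordinates in `s` vary. -/
def flat (a : AffinePoints F ι) (s : Set ι) : Set (AffinePoints F ι) :=
  {x | ∀ j, j ∉ s → x j = a j}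

theorem isClosed_flat (a : AffinePoints F ι) (s : Set ι) : IsClosed (flat a s) := by
  have : flat a s = ⋂ j, ⋂ _ : j ∉ s,
      {x : AffinePoints F ι | x.eval (MvPolynomial.X j - MvPolynomial.C (a j)) = 0} := by
    ext x
    simp [flat, sub_eq_zero]
  rw [this]
  exact isClosed_iInter fun j => isClosed_iInter fun _ => isClosed_eq _

-- A flat is the image of the irreducible affine space under the continuous retraction that freezes
-- the coordinates outside `s`.
open Classical in
theorem isIrreducible_flat [Infinite F] (a : AffinePoints F ι) (s : Set ι) :
    IsIrreducible (flat a s) := by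
  let r : AffinePoints F ι → AffinePoints F ι := fun x j => if j ∈ s then x j else a j
  have hr : Continuous r := by
    rw [continuous_iff]
    intro G
    convert isOpen_ne (MvPolynomial.bind₁ (fun j : ι => if j ∈ s then MvPolynomial.X j
      else MvPolynomial.C (a j)) G) using 3 with x
    refine not_congr (Eq.congr ?_ rfl)
    refine Eq.trans ?_ (MvPolynomial.eval₂Hom_bind₁ (RingHom.id F) x _ G).symm
    refine congrArg (fun y : AffinePoints F ι => y.eval G) (funext fun j => ?_)
    by_cases hj : j ∈ s
    · simp only [r, hj, if_true]
      exact (eval_X x j).symm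
    · simp only [r, hj, if_false]
      exact (eval_C x (a j)).symm
  have : flat a s = r '' Set.univ := by
    ext x
    simp only [flat, Set.mem_ofPred_eq, Set.image_univ, Set.mem_range]
    constructor
    · intro h
      refine ⟨x, funext fun j => ?_⟩
      by_cases hj : j ∈ s
      · simp [r, hj]
      · simp [r, hj, h j hj]
    · rintro ⟨y, rfl⟩ j hj
      simp [r, hj]
  rw [this]
  exact (IrreducibleSpace.isIrreducible_univ _).image r hr.continuousOn

theorem isIrreducible_flat_inter [Infinite F] {h : MvPolynomial ι F} (a : AffinePoints F ι)
    (ha : a.eval h ≠ 0) (s : Set ι) :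
    IsIrreducible ((↑) ⁻¹' flat a s : Set {x : AffinePoints F ι // x.eval h ≠ 0}) := by
  refine ⟨⟨⟨a, ha⟩, fun j _ => rfl⟩, ?_⟩
  exact (isIrreducible_flat a s).2.preimage (isOpen_ne h).isOpenEmbedding_subtypeVal

theorem flat_ssubset [Infinite F] {h : MvPolynomial ι F} (a : AffinePoints F ι)
    (ha : a.eval h ≠ 0) {s t : Set ι} (hst : s ⊂ t) :
    ((↑) ⁻¹' flat a s : Set {x : AffinePoints F ι // x.eval h ≠ 0}) ⊂ (↑) ⁻¹' flat a t := by
  classical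
  obtain ⟨hst, i, hit, his⟩ := Set.ssubset_iff_exists.1 hst
  refine Set.ssubset_iff_exists.2 ⟨fun x hx j hj => hx j fun h => hj (hst h), ?_⟩
  obtain ⟨b, hb⟩ := exists_ne (a i)
  let a' : AffinePoints F ι := fun j => if j = i then b else a j
  have ha' : a' ∈ flat a t := fun j hj => if_neg (by rintro rfl; exact hj hit)
  have hi : a'.eval (MvPolynomial.X i - MvPolynomial.C (a i)) ≠ 0 := by
    rw [map_sub, eval_X, eval_C]
    exact sub_ne_zero.2 ((if_pos rfl).trans_ne hb)
  -- The larger flat is irreducible and meets both `h ≠ 0` (at `a`) and `x i ≠ a i` (at `a'`), so it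
  -- meets their intersection.
  have := (isIrreducible_flat a t).2 _ _ (isOpen_ne h)
    (isOpen_ne (MvPolynomial.X i - MvPolynomial.C (a i))) ⟨a, fun _ _ => rfl, ha⟩ ⟨a', ha', hi⟩
  obtain ⟨x, hx, hxh, hxi⟩ := this
  refine ⟨⟨x, hxh⟩, hx, fun h => hxi ?_⟩
  rw [map_sub, eval_X, eval_C]
  exact sub_eq_zero.2 (h i his)

/-- Flats through a point `a` of the open set, with one more coordinate freed at each step, form a
strict chain of irreducible closed subsets. -/
theorem card_le_topologicalKrullDim [Infinite F] [Finite ι] {h : MvPolynomial ι F} (hh : h ≠ 0) :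
    Nat.card ι ≤ topologicalKrullDim {x : AffinePoints F ι // x.eval h ≠ 0} := by
  obtain ⟨a, ha⟩ := exists_eval_ne_zero hh
  let e := Finite.equivFin ι
  let c : LTSeries (TopologicalSpace.IrreducibleCloseds {x : AffinePoints F ι // x.eval h ≠ 0}) :=
    LTSeries.mk (Nat.card ι) (fun i => ⟨(↑) ⁻¹' flat a {j | (e j : ℕ) < i},
      isIrreducible_flat_inter a ha _, (isClosed_flat a _).preimage continuous_subtype_val⟩) (by
        intro i k hik
        refine SetLike.coe_ssubset_coe.1 (flat_ssubset a ha ?_)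
        refine Set.ssubset_iff_exists.2 ⟨fun j hj => Nat.lt_trans hj hik, ?_⟩
        exact ⟨e.symm ⟨i, by lia⟩, by simpa using hik, by simp⟩)
  exact Order.LTSeries.length_le_krullDim c

theorem topologicalKrullDim_eq_card [Infinite F] [Finite ι] {h : MvPolynomial ι F} (hh : h ≠ 0)
    {Q : Type*} [TopologicalSpace Q] (f : Q ≃ₜ {x : AffinePoints F ι // x.eval h ≠ 0}) :
    topologicalKrullDim Q = Nat.card ι := by
  rw [IsHomeomorph.topologicalKrullDim_eq _ f.isHomeomorph]
  exact le_antisymm ((topologicalKrullDim_subspace_le _ _).trans topologicalKrullDim_le)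
    (card_le_topologicalKrullDim hh)

end AffinePoints

end Unicritical

namespace Unicritical

open Polynomial

variable {F : Type*} [Field F] {d : ℕ}

/-! ### Coefficient matrices, their rows and the Wronskian -/

section rowPoly

theorem coeff_rowPoly (M : Matrix (Fin 2) (Fin (d + 1)) F) (i : Fin 2) (j : Fin (d + 1)) :
    (rowPoly M i).coeff j = M i j := by
  simp only [rowPoly, finsetSum_coeff, coeff_monomial]
  rw [Finset.sum_eq_single j]
  · simp
  · intro k _ hk
    exact if_neg fun h => hk (Fin.ext h)
  · simp

theorem natDegree_rowPoly_le (M : Matrix (Fin 2) (Fin (d + 1)) F) (i : Fin 2) :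
    (rowPoly M i).natDegree ≤ d :=
  natDegree_sum_le_of_forall_le _ _ fun j _ =>
    (natDegree_monomial_le _).trans (Nat.lt_succ_iff.1 j.2)

theorem rowPoly_eq_of_coeff {M : Matrix (Fin 2) (Fin (d + 1)) F} {i : Fin 2} {f : F[X]}
    (hf : f.natDegree ≤ d) (h : ∀ j : Fin (d + 1), M i j = f.coeff j) : rowPoly M i = f := by
  ext k
  by_cases hk : k < d + 1
  · exact (coeff_rowPoly M i ⟨k, hk⟩).trans (h ⟨k, hk⟩)
  · rw [coeff_eq_zero_of_natDegree_lt (by have := natDegree_rowPoly_le M i; lia),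
      coeff_eq_zero_of_natDegree_lt (by lia)]

theorem rowPoly_injective {M N : Matrix (Fin 2) (Fin (d + 1)) F}
    (h : ∀ i, rowPoly M i = rowPoly N i) : M = N := by
  ext i j
  rw [← coeff_rowPoly M, h, coeff_rowPoly]

theorem rowPoly_smul (a : F) (M : Matrix (Fin 2) (Fin (d + 1)) F) (i : Fin 2) :
    rowPoly (a • M) i = C a * rowPoly M i := by
  refine rowPoly_eq_of_coeff ((natDegree_C_mul_le _ _).trans (natDegree_rowPoly_le M i)) fun j => ?_
  rw [coeff_C_mul, coeff_rowPoly, Matrix.smul_apply, smul_eq_mul]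

theorem rowPoly_mul (A : Matrix (Fin 2) (Fin 2) F) (M : Matrix (Fin 2) (Fin (d + 1)) F)
    (i : Fin 2) :
    rowPoly (A * M) i = C (A i 0) * rowPoly M 0 + C (A i 1) * rowPoly M 1 := by
  refine rowPoly_eq_of_coeff (natDegree_add_le_of_degree_le
    ((natDegree_C_mul_le _ _).trans (natDegree_rowPoly_le M _))
    ((natDegree_C_mul_le _ _).trans (natDegree_rowPoly_le M _))) fun j => ?_
  simp [coeff_rowPoly, Matrix.mul_apply]

theorem rowPoly_invSource (M : Matrix (Fin 2) (Fin (d + 1)) F) (i : Fin 2) :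
    rowPoly (invSource M) i = (rowPoly M i).reflect d := by
  refine rowPoly_eq_of_coeff
    (natDegree_reflect_le.trans (max_le le_rfl (natDegree_rowPoly_le M i))) fun j => ?_
  rw [coeff_reflect, revAt_le (Nat.lt_succ_iff.1 j.2)]
  have : d - (j : ℕ) = (j.rev : Fin (d + 1)) := by simp [Fin.val_rev]
  rw [this, coeff_rowPoly]
  rfl

/-- The Wronskian of the two rows. -/
noncomputable def rowWronskian (M : Matrix (Fin 2) (Fin (d + 1)) F) : F[X] :=
  wronskian (rowPoly M 0) (rowPoly M 1)

theorem rowWronskian_mul (A : Matrix (Fin 2) (Fin 2) F) (M : Matrix (Fin 2) (Fin (d + 1)) F) :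
    rowWronskian (A * M) = C A.det * rowWronskian M := by
  simp only [rowWronskian, rowPoly_mul, wronskian, Matrix.det_fin_two, derivative_add,
    derivative_C_mul, C_sub, C_mul]
  ring

end rowPoly

/-! ### Ramification through the Wronskian -/

section ramification

/-- The polynomial `g(a) f - f(a) g` vanishes at `a`, and its derivative there is minus the
Wronskian. If it is identically zero, `rootMultiplicity` returns `0`, consistently with a vanishing
Wronskian. -/
theorem ramIndexFinite_eq_one_iff (M : Matrix (Fin 2) (Fin (d + 1)) F) (a : F) :
    ramIndexFinite M a = 1 ↔ (rowWronskian M).eval a ≠ 0 := by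
  unfold ramIndexFinite
  set h := C ((rowPoly M 1).eval a) * rowPoly M 0 - C ((rowPoly M 0).eval a) * rowPoly M 1 with hh
  have h0 : h.IsRoot a := by simp [hh, mul_comm]
  have h1 : (derivative h).eval a = -(rowWronskian M).eval a := by
    simp [hh, rowWronskian, wronskian]
    ring
  rcases eq_or_ne h 0 with hz | hz
  · rw [hz] at h1 ⊢
    simpa using h1
  · have hpos : 0 < h.rootMultiplicity a := (rootMultiplicity_pos hz).2 h0
    have hone := one_lt_rootMultiplicity_iff_isRoot (t := a) hz
    rw [IsRoot.def, IsRoot.def, h1, neg_eq_zero] at hone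
    have h0' : h.eval a = 0 := h0
    constructor
    · intro h2 h3
      have := hone.2 ⟨h0', h3⟩
      lia
    · intro h2
      have : ¬ 1 < h.rootMultiplicity a := fun h3 => h2 (hone.1 h3).2
      lia

theorem ramIndexFinite_smul {a : F} (ha : a ≠ 0) (M : Matrix (Fin 2) (Fin (d + 1)) F) (b : F) :
    ramIndexFinite (a • M) b = ramIndexFinite M b := by
  unfold ramIndexFinite
  set h := C ((rowPoly M 1).eval b) * rowPoly M 0 - C ((rowPoly M 0).eval b) * rowPoly M 1 with hh
  have : C ((rowPoly (a • M) 1).eval b) * rowPoly (a • M) 0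
      - C ((rowPoly (a • M) 0).eval b) * rowPoly (a • M) 1 = C (a ^ 2) * h := by
    simp only [hh, rowPoly_smul, eval_mul, eval_C, C_mul, C_pow]
    ring
  rw [this]
  rcases eq_or_ne h 0 with hz | hz
  · simp [hz]
  · rw [rootMultiplicity_mul (mul_ne_zero (by simpa using ha) hz), rootMultiplicity_C, zero_add]

theorem ramIndex_infty (M : Matrix (Fin 2) (Fin (d + 1)) F) :
    ramIndex M OnePoint.infty = ramIndexFinite (invSource M) 0 := rfl

theorem ramIndex_coe (M : Matrix (Fin 2) (Fin (d + 1)) F) (a : F) :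
    ramIndex M (a : OnePoint F) = ramIndexFinite M a := rfl

theorem invSource_smul (a : F) (M : Matrix (Fin 2) (Fin (d + 1)) F) :
    invSource (a • M) = a • invSource M := rfl

theorem ramIndex_smul {a : F} (ha : a ≠ 0) (M : Matrix (Fin 2) (Fin (d + 1)) F)
    (y : OnePoint F) : ramIndex (a • M) y = ramIndex M y := by
  induction y using OnePoint.rec with
  | infty => rw [ramIndex_infty, ramIndex_infty, invSource_smul, ramIndexFinite_smul ha]
  | coe b => rw [ramIndex_coe, ramIndex_coe, ramIndexFinite_smul ha]

theorem eval_rowPoly_ne_zero {M : Matrix (Fin 2) (Fin (d + 1)) F} {a : F}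
    (h : ramIndexFinite M a ≠ 0) : (rowPoly M 0).eval a ≠ 0 ∨ (rowPoly M 1).eval a ≠ 0 := by
  by_contra! h0
  exact h (by simp [ramIndexFinite, h0])

theorem rowPoly_invSource_eval_zero (M : Matrix (Fin 2) (Fin (d + 1)) F) (i : Fin 2) :
    (rowPoly (invSource M) i).eval 0 = (rowPoly M i).coeff d := by
  rw [rowPoly_invSource, ← coeff_zero_eq_eval_zero, coeff_reflect, revAt_le (Nat.zero_le _),
    Nat.sub_zero]

/-- When `f` has exact degree `d`, raising the formal degree of `g` only contributes a power of the
leading coefficient of `f`. -/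
theorem resultant_ne_zero_of_coeff {f g : F[X]} (hf : f.natDegree = d) (hg : g.natDegree ≤ d)
    (hf0 : f ≠ 0) (hfg : IsCoprime f g) : resultant f g d d ≠ 0 := by
  obtain ⟨k, hk⟩ := Nat.exists_eq_add_of_le hg
  have h := resultant_add_right_deg f g d g.natDegree k le_rfl
  rw [← hk] at h
  rw [h]
  refine mul_ne_zero (pow_ne_zero _ ?_) ?_
  · rw [← hf]
    simpa using hf0
  · have := resultant_ne_zero f g hfg
    rwa [hf] at this

/-- A common zero of the rows, at a finite point or at `∞`, would give index `0` there. The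
ramification conditions therefore already imply the resultant condition. -/
theorem resultant_rowPoly_ne_zero [IsAlgClosed F] {M : Matrix (Fin 2) (Fin (d + 1)) F}
    (h : ∀ y, ramIndex M y ≠ 0) : resultant (rowPoly M 0) (rowPoly M 1) d d ≠ 0 := by
  have hcop : IsCoprime (rowPoly M 0) (rowPoly M 1) := by
    rw [isCoprime_iff_aeval_ne_zero_of_isAlgClosed F F]
    intro a
    simpa using eval_rowPoly_ne_zero (h a)
  have hinf := eval_rowPoly_ne_zero (h OnePoint.infty)
  simp only [rowPoly_invSource_eval_zero] at hinf
  rcases hinf with h0 | h0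
  · exact resultant_ne_zero_of_coeff
      ((natDegree_rowPoly_le M 0).antisymm (le_natDegree_of_ne_zero h0))
      (natDegree_rowPoly_le M 1) (by rintro hz; simp [hz] at h0) hcop
  · rw [resultant_comm]
    exact mul_ne_zero (pow_ne_zero _ (neg_ne_zero.2 one_ne_zero)) (resultant_ne_zero_of_coeff
      ((natDegree_rowPoly_le M 1).antisymm (le_natDegree_of_ne_zero h0))
      (natDegree_rowPoly_le M 0) (by rintro hz; simp [hz] at h0) hcop.symm)

theorem mk_mem_ramLocus_iff [IsAlgClosed F] {e : ℕ} (he : e ≠ 0) (c : OnePoint F)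
    {M : Matrix (Fin 2) (Fin (d + 1)) F} (hM : M ≠ 0) :
    Projectivization.mk F M hM ∈ ramLocus d e c ↔
      ramIndex M c = e ∧ ∀ y, y ≠ c → ramIndex M y = 1 := by
  obtain ⟨a, ha⟩ := Projectivization.exists_smul_eq_mk_rep F M hM
  have ha' : (Projectivization.mk F M hM).rep = (a : F) • M := ha.symm
  have key : ∀ y, ramIndex (Projectivization.mk F M hM).rep y = ramIndex M y := fun y => by
    rw [ha', ramIndex_smul a.ne_zero]
  simp only [ramLocus, Set.mem_ofPred_eq, key, and_iff_right_iff_imp]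
  rintro ⟨h1, h2⟩
  refine resultant_rowPoly_ne_zero fun y => ?_
  rw [key]
  by_cases hy : y = c
  · rwa [hy, h1]
  · rw [h2 y hy]
    exact one_ne_zero

end ramification

/-! ### Minors and ramification at infinity -/

section minors

/-- The `2 × 2` minors of the coefficient matrix, as functions of two exponents. -/
noncomputable def minor (M : Matrix (Fin 2) (Fin (d + 1)) F) (i j : ℕ) : F :=
  (rowPoly M 0).coeff i * (rowPoly M 1).coeff j - (rowPoly M 0).coeff j * (rowPoly M 1).coeff i

theorem minor_mul (A : Matrix (Fin 2) (Fin 2) F) (M : Matrix (Fin 2) (Fin (d + 1)) F) (i j : ℕ) :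
    minor (A * M) i j = A.det * minor M i j := by
  simp only [minor, rowPoly_mul, coeff_add, coeff_C_mul, Matrix.det_fin_two]
  ring

theorem rootMultiplicity_zero_eq_iff {f : F[X]} {e : ℕ} (he : e ≠ 0) :
    f.rootMultiplicity 0 = e ↔ (∀ j < e, f.coeff j = 0) ∧ f.coeff e ≠ 0 := by
  rw [rootMultiplicity_eq_natTrailingDegree']
  constructor
  · rintro rfl
    refine ⟨fun j hj => coeff_eq_zero_of_lt_natTrailingDegree hj, ?_⟩
    have : f ≠ 0 := by rintro rfl; simp at he
    exact trailingCoeff_nonzero_iff_nonzero.2 this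
  · rintro ⟨h1, h2⟩
    exact le_antisymm (natTrailingDegree_le_of_ne_zero h2)
      (le_natTrailingDegree (by rintro rfl; simp at h2) h1)

theorem ramIndex_infty_eq_iff {e : ℕ} (he : e ≠ 0) (hed : e ≤ d)
    (M : Matrix (Fin 2) (Fin (d + 1)) F) :
    ramIndex M OnePoint.infty = e ↔
      (∀ j, d - e < j → minor M d j = 0) ∧ minor M d (d - e) ≠ 0 := by
  -- The local expansion at `∞` has the minors of column `d` with columns `d, d - 1, …` as
  -- coefficients, up to sign.
  have hc : ∀ j ≤ d, (C ((rowPoly (invSource M) 1).eval 0) * rowPoly (invSource M) 0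
    - C ((rowPoly (invSource M) 0).eval 0) * rowPoly (invSource M) 1).coeff j =
      - minor M d (d - j) := by
    intro j hj
    simp only [rowPoly_invSource_eval_zero]
    simp only [coeff_sub, coeff_C_mul, rowPoly_invSource, coeff_reflect, revAt_le hj, minor]
    ring
  rw [ramIndex_infty, ramIndexFinite, rootMultiplicity_zero_eq_iff he, hc e hed, neg_ne_zero]
  refine and_congr_left' ⟨fun h j hj => ?_, fun h j hj => ?_⟩
  · by_cases hjd : j ≤ d
    · have := h (d - j) (by lia)
      rw [hc _ (Nat.sub_le _ _), neg_eq_zero, Nat.sub_sub_self hjd] at this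
      exact this
    · simp [minor, coeff_eq_zero_of_natDegree_lt ((natDegree_rowPoly_le M _).trans_lt
        (not_le.1 hjd))]
  · rw [hc j (by lia), h _ (by lia), neg_zero]

theorem mk_mem_ramLocus_infty_iff [IsAlgClosed F] {e : ℕ} (he : e ≠ 0) (hed : e ≤ d)
    {M : Matrix (Fin 2) (Fin (d + 1)) F} (hM : M ≠ 0) :
    Projectivization.mk F M hM ∈ ramLocus d e OnePoint.infty ↔
      ((∀ j, d - e < j → minor M d j = 0) ∧ minor M d (d - e) ≠ 0) ∧
        ∃ κ : F, κ ≠ 0 ∧ rowWronskian M = C κ := by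
  rw [mk_mem_ramLocus_iff he, ramIndex_infty_eq_iff he hed]
  refine and_congr_right' ⟨fun h => ?_, ?_⟩
  · have h0 : ∀ a : F, (rowWronskian M).eval a ≠ 0 := fun a =>
      (ramIndexFinite_eq_one_iff M a).1 (h a (OnePoint.coe_ne_infty a))
    have hdeg : (rowWronskian M).degree = 0 := by
      by_contra hdeg
      obtain ⟨a, ha⟩ := IsAlgClosed.exists_root _ hdeg
      exact h0 a ha
    have hC := eq_C_of_degree_eq_zero hdeg
    refine ⟨_, fun hz => h0 0 ?_, hC⟩
    rw [hC, hz]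
    simp
  · rintro ⟨κ, hκ, hW⟩ y hy
    induction y using OnePoint.rec with
    | infty => exact absurd rfl hy
    | coe a =>
      refine (ramIndexFinite_eq_one_iff M a).2 ?_
      rwa [hW, eval_C]

end minors

end Unicritical

namespace Unicritical

open Polynomial

variable {F : Type*} [Field F] {d : ℕ}

/-! ### Continuity on the projective coefficient space -/

section continuity

theorem eval_smul_of_isHomogeneous {σ : Type*} {G : MvPolynomial σ F} {n : ℕ}
    (hG : G.IsHomogeneous n) (a : F) (x : σ → F) :
    MvPolynomial.eval (fun k => a * x k) G = a ^ n * MvPolynomial.eval x G := by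
  rw [MvPolynomial.eval_eq, MvPolynomial.eval_eq, Finset.mul_sum]
  refine Finset.sum_congr rfl fun s hs => ?_
  rw [← hG (MvPolynomial.mem_support_iff.1 hs)]
  simp only [mul_pow, Finset.prod_mul_distrib, Finset.prod_pow_eq_pow_sum, Finsupp.weight_apply,
    Pi.one_apply, smul_eq_mul, mul_one]
  rw [Finsupp.sum]
  ring

/-- The value of a polynomial in the coefficients. -/
noncomputable def coeffEval (M : Matrix (Fin 2) (Fin (d + 1)) F) :
    MvPolynomial (Fin 2 × Fin (d + 1)) F →+* F :=
  MvPolynomial.eval fun k => M k.1 k.2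

theorem coeffEval_smul {G : MvPolynomial (Fin 2 × Fin (d + 1)) F} {n : ℕ}
    (hG : G.IsHomogeneous n) (a : F) (M : Matrix (Fin 2) (Fin (d + 1)) F) :
    coeffEval (a • M) G = a ^ n * coeffEval M G :=
  eval_smul_of_isHomogeneous hG a _

theorem coeffEval_rep_mk_ne_zero_iff {G : MvPolynomial (Fin 2 × Fin (d + 1)) F} {n : ℕ}
    (hG : G.IsHomogeneous n) {M : Matrix (Fin 2) (Fin (d + 1)) F} (hM : M ≠ 0) :
    coeffEval (Projectivization.mk F M hM).rep G ≠ 0 ↔ coeffEval M G ≠ 0 := by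
  obtain ⟨a, ha⟩ := Projectivization.exists_smul_eq_mk_rep F M hM
  have ha' : (Projectivization.mk F M hM).rep = (a : F) • M := ha.symm
  rw [ha', coeffEval_smul hG, mul_ne_zero_iff, and_iff_right (pow_ne_zero _ a.ne_zero)]

theorem isOpen_coeffEval_ne_zero {G : MvPolynomial (Fin 2 × Fin (d + 1)) F} {n : ℕ}
    (hG : G.IsHomogeneous n) : IsOpen {x : CoeffSpace F d | coeffEval x.rep G ≠ 0} :=
  TopologicalSpace.isOpen_generateFrom_of_mem ⟨n, G, hG, rfl⟩

theorem continuous_mk {Y : Type*} [TopologicalSpace Y] {v : Y → Matrix (Fin 2) (Fin (d + 1)) F}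
    (hv : ∀ y, v y ≠ 0)
    (h : ∀ G : MvPolynomial (Fin 2 × Fin (d + 1)) F, ∀ n, G.IsHomogeneous n →
      IsOpen {y | coeffEval (v y) G ≠ 0}) :
    Continuous fun y => (Projectivization.mk F (v y) (hv y) : CoeffSpace F d) := by
  refine continuous_generateFrom_iff.2 ?_
  rintro _ ⟨n, G, hG, rfl⟩
  convert h G n hG using 1
  ext y
  exact coeffEval_rep_mk_ne_zero_iff hG (hv y)

/-- Substituting the linear forms `q` that express `L` turns a form into a form of the same degree.
-/
theorem continuous_projectivizationMap
    (L : Matrix (Fin 2) (Fin (d + 1)) F →ₗ[F] Matrix (Fin 2) (Fin (d + 1)) F)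
    (hL : Function.Injective L) :
    Continuous (Projectivization.map L hL : CoeffSpace F d → CoeffSpace F d) := by
  have hmap : (Projectivization.map L hL : CoeffSpace F d → CoeffSpace F d) =
      fun x : CoeffSpace F d => Projectivization.mk F (L x.rep)
        (fun h => x.rep_nonzero (hL (h.trans (map_zero L).symm))) := by
    funext x
    conv_lhs => rw [← x.mk_rep]
    rw [Projectivization.map_mk]
  rw [hmap]
  refine continuous_mk _ fun G n hG => ?_
  let q : Fin 2 × Fin (d + 1) → MvPolynomial (Fin 2 × Fin (d + 1)) F := fun k =>
    ∑ i, ∑ j, MvPolynomial.C (L (Matrix.single i j 1) k.1 k.2) * MvPolynomial.X (i, j)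
  have hq : ∀ k, (q k).IsHomogeneous 1 := fun k =>
    MvPolynomial.IsHomogeneous.sum _ _ _ fun i _ => MvPolynomial.IsHomogeneous.sum _ _ _
      fun j _ => MvPolynomial.isHomogeneous_C_mul_X _ _
  convert isOpen_coeffEval_ne_zero (hG.aeval q hq) using 3 with x
  refine not_congr (Eq.congr ?_ rfl)
  refine Eq.trans ?_ (MvPolynomial.eval₂Hom_bind₁ (RingHom.id F) _ _ G).symm
  refine congrArg (fun w => MvPolynomial.eval w G) (funext fun k => ?_)
  refine Eq.trans ?_ (show MvPolynomial.eval (fun k => x.rep k.1 k.2) (q k) = _ from rfl)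
  conv_lhs => rw [Matrix.matrix_eq_sum_single x.rep]
  have hs : ∀ i j, Matrix.single i j (x.rep i j) = x.rep i j • Matrix.single i j (1 : F) := by
    intro i j
    rw [Matrix.smul_single, smul_eq_mul, mul_one]
  simp only [hs, map_sum, map_smul, Matrix.sum_apply, Matrix.smul_apply, smul_eq_mul, q, map_mul,
    MvPolynomial.eval_C, MvPolynomial.eval_X, mul_comm]

end continuity

/-! ### Moving the ramified point to infinity -/

section change_of_source

/-- The Euler operator `h ↦ X h'` preserves the formal degree `d`, unlike the derivative, and
satisfies the `key` identity under reflection. The two terms with factor `d` cancel in the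
Wronskian. -/
theorem wronskian_reflect {f g : F[X]} (hf : f.natDegree ≤ d) (hg : g.natDegree ≤ d) :
    X * wronskian (f.reflect d) (g.reflect d) = -(X * wronskian f g).reflect (d + d) := by
  have key : ∀ h : F[X], h.natDegree ≤ d →
      X * derivative (h.reflect d) = C (d : F) * h.reflect d - (X * derivative h).reflect d := by
    intro h hh
    ext j
    have hX : ∀ (q : F[X]) (j : ℕ), (X * derivative q).coeff j = j * q.coeff j := by
      rintro q (_ | j)
      · simp
      · rw [coeff_X_mul, coeff_derivative]
        push_cast
        ring
    rw [hX, coeff_sub, coeff_C_mul, coeff_reflect, coeff_reflect, hX]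
    by_cases hj : j ≤ d
    · rw [revAt_le hj, Nat.cast_sub hj]
      ring
    · rw [revAt_eq_self_of_lt (not_le.1 hj), coeff_eq_zero_of_natDegree_lt (by lia)]
      ring
  have hX : ∀ h : F[X], h.natDegree ≤ d → (X * derivative h).natDegree ≤ d := by
    intro h hh
    rcases Nat.eq_zero_or_pos h.natDegree with h0 | h0
    · rw [derivative_of_natDegree_zero h0]
      simp
    · have := natDegree_derivative_le h
      refine natDegree_mul_le.trans ?_
      have := natDegree_X_le (R := F)
      lia
  have hw : X * wronskian f g = f * (X * derivative g) - (X * derivative f) * g := by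
    rw [wronskian]
    ring
  rw [hw, reflect_sub, reflect_mul _ _ hf (hX g hg), reflect_mul _ _ (hX f hf) hg]
  have h1 := key f hf
  have h2 := key g hg
  calc X * wronskian (f.reflect d) (g.reflect d)
      = f.reflect d * (X * derivative (g.reflect d)) - (X * derivative (f.reflect d)) *
        g.reflect d := by rw [wronskian]; ring
    _ = _ := by rw [h1, h2]; ring

theorem wronskian_reflect_eval_ne_zero_iff {f g : F[X]} (hf : f.natDegree ≤ d)
    (hg : g.natDegree ≤ d) {b : F} (hb : b ≠ 0) :
    (wronskian (f.reflect d) (g.reflect d)).eval b ≠ 0 ↔ (wronskian f g).eval b⁻¹ ≠ 0 := by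
  have hdeg : (X * wronskian f g).natDegree ≤ d + d := by
    rcases eq_or_ne (wronskian f g) 0 with h0 | h0
    · simp [h0]
    · have := natDegree_wronskian_lt_add h0
      rw [natDegree_X_mul h0]
      lia
  let _ : Invertible b⁻¹ := invertibleOfNonzero (inv_ne_zero hb)
  have h := eval₂_reflect_eq_zero_iff (RingHom.id F) b⁻¹ (d + d) (X * wronskian f g) hdeg
  have h2 := congrArg (eval b) (wronskian_reflect hf hg)
  rw [invOf_eq_inv, inv_inv, eval₂_id, eval₂_id] at h
  rw [eval_neg, eval_mul, eval_X] at h2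
  rw [eval_mul, eval_X, mul_eq_zero, or_iff_right (inv_ne_zero hb)] at h
  rw [ne_eq, ne_eq, ← h, ← neg_eq_zero (a := eval b (reflect _ _)), ← h2, mul_eq_zero,
    or_iff_right hb]

theorem wronskian_reflect_eval_zero {f g : F[X]} (hf : f.natDegree ≤ d) (hg : g.natDegree ≤ d)
    (hd : d ≠ 0) :
    (wronskian (f.reflect d) (g.reflect d)).eval 0 = -(wronskian f g).coeff (2 * d - 2) := by
  have h := congrArg (fun q => coeff q 1) (wronskian_reflect hf hg)
  rw [show (1 : ℕ) = 0 + 1 from rfl, coeff_X_mul, coeff_zero_eq_eval_zero] at h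
  rw [h, coeff_neg, coeff_reflect, revAt_le (by lia),
    show d + d - (0 + 1) = 2 * d - 2 + 1 by lia, coeff_X_mul]

/-- The naive bound is `2 d - 1`. The constant term of the reflection identity shows that the
coefficient at `2 d - 1` is zero, since the other side is divisible by `X`. -/
theorem natDegree_wronskian_le {f g : F[X]} (hf : f.natDegree ≤ d) (hg : g.natDegree ≤ d)
    (hd : d ≠ 0) : (wronskian f g).natDegree ≤ 2 * d - 2 := by
  have h := congrArg (fun q => coeff q 0) (wronskian_reflect hf hg)
  rw [coeff_X_mul_zero, coeff_neg, coeff_reflect, revAt_le (Nat.zero_le _),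
    show d + d - 0 = 2 * d - 1 + 1 by lia, coeff_X_mul, zero_eq_neg] at h
  rcases eq_or_ne (wronskian f g) 0 with h0 | h0
  · simp [h0]
  · have h1 := natDegree_wronskian_lt_add h0
    have h2 : (wronskian f g).natDegree ≠ 2 * d - 1 := by
      intro h2
      rw [← h2] at h
      exact h0 (leadingCoeff_eq_zero.1 h)
    lia

theorem coeff_taylor_of_natDegree_le (c : F) {f : F[X]} {n : ℕ} (hf : f.natDegree ≤ n) :
    (taylor c f).coeff n = f.coeff n := by
  rcases hf.eq_or_lt with rfl | h
  · exact coeff_taylor_natDegree _ _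
  · rw [coeff_eq_zero_of_natDegree_lt h, coeff_eq_zero_of_natDegree_lt (by rwa [natDegree_taylor])]

theorem wronskian_taylor (c : F) (f g : F[X]) :
    wronskian (taylor c f) (taylor c g) = taylor c (wronskian f g) := by
  have h : ∀ q : F[X], derivative (taylor c q) = taylor c (derivative q) := fun q => by
    simp [taylor_apply, derivative_comp]
  simp only [wronskian, h, map_sub, taylor_mul]

theorem rowPoly_add (M N : Matrix (Fin 2) (Fin (d + 1)) F) (i : Fin 2) :
    rowPoly (M + N) i = rowPoly M i + rowPoly N i :=
  rowPoly_eq_of_coeff (natDegree_add_le_of_degree_le (natDegree_rowPoly_le _ _)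
    (natDegree_rowPoly_le _ _)) fun j => by
      rw [coeff_add, coeff_rowPoly, coeff_rowPoly, Matrix.add_apply]

/-- The matrix with prescribed rows. -/
noncomputable def ofRows (d : ℕ) (f : Fin 2 → F[X]) : Matrix (Fin 2) (Fin (d + 1)) F :=
  Matrix.of fun i j => (f i).coeff j

theorem rowPoly_ofRows {f : Fin 2 → F[X]} (hf : ∀ i, (f i).natDegree ≤ d) (i : Fin 2) :
    rowPoly (ofRows d f) i = f i :=
  rowPoly_eq_of_coeff (hf i) fun _ => rfl

theorem natDegree_taylor_rowPoly_le (c : F) (M : Matrix (Fin 2) (Fin (d + 1)) F) (i : Fin 2) :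
    (taylor c (rowPoly M i)).natDegree ≤ d := by
  rw [natDegree_taylor]
  exact natDegree_rowPoly_le M i

/-- Precomposition with `z ↦ c + 1 / z`, on coefficient matrices. -/
noncomputable def sourceChange (c : F) :
    Matrix (Fin 2) (Fin (d + 1)) F ≃ₗ[F] Matrix (Fin 2) (Fin (d + 1)) F where
  toFun M := ofRows d fun i => (taylor c (rowPoly M i)).reflect d
  invFun M := ofRows d fun i => taylor (-c) ((rowPoly M i).reflect d)
  map_add' M N := by
    ext i j
    simp [ofRows, rowPoly_add]
  map_smul' a M := by
    ext i j
    simp [ofRows, rowPoly_smul, taylor_mul]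
  left_inv M := by
    refine rowPoly_injective fun i => ?_
    have h (i : Fin 2) : ((taylor c (rowPoly M i)).reflect d).natDegree ≤ d :=
      natDegree_reflect_le.trans (max_le le_rfl (natDegree_taylor_rowPoly_le c M i))
    simp only [rowPoly_ofRows h, reflect_reflect, taylor_taylor, neg_add_cancel, taylor_zero]
    exact rowPoly_ofRows (natDegree_rowPoly_le M) i
  right_inv M := by
    refine rowPoly_injective fun i => ?_
    have h (i : Fin 2) : (taylor (-c) ((rowPoly M i).reflect d)).natDegree ≤ d := by
      rw [natDegree_taylor]
      exact natDegree_reflect_le.trans (max_le le_rfl (natDegree_rowPoly_le M i))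
    simp only [rowPoly_ofRows h, taylor_taylor, add_neg_cancel, taylor_zero, reflect_reflect]
    exact rowPoly_ofRows (natDegree_rowPoly_le M) i

theorem rowPoly_sourceChange (c : F) (M : Matrix (Fin 2) (Fin (d + 1)) F) (i : Fin 2) :
    rowPoly (sourceChange c M) i = (taylor c (rowPoly M i)).reflect d :=
  rowPoly_ofRows (fun i => natDegree_reflect_le.trans
    (max_le le_rfl (natDegree_taylor_rowPoly_le c M i))) i

theorem sourceChange_mul (c : F) (A : Matrix (Fin 2) (Fin 2) F)
    (M : Matrix (Fin 2) (Fin (d + 1)) F) :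
    sourceChange c (A * M) = A * sourceChange c M := by
  refine rowPoly_injective fun i => ?_
  simp only [rowPoly_sourceChange, rowPoly_mul, map_add, taylor_mul, taylor_C, reflect_add,
    reflect_C_mul]

theorem ramIndex_sourceChange_infty (c : F) (M : Matrix (Fin 2) (Fin (d + 1)) F) :
    ramIndex (sourceChange c M) OnePoint.infty = ramIndex M c := by
  rw [ramIndex_infty, ramIndex_coe, ramIndexFinite, ramIndexFinite,
    rootMultiplicity_eq_rootMultiplicity (t := c), ← taylor_apply]
  simp only [rowPoly_invSource, rowPoly_sourceChange, reflect_reflect, ← coeff_zero_eq_eval_zero,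
    taylor_coeff_zero, map_sub, taylor_mul, taylor_C]

theorem ramIndex_sourceChange_coe (c : F) {b : F} (hb : b ≠ 0)
    (M : Matrix (Fin 2) (Fin (d + 1)) F) :
    ramIndex (sourceChange c M) b = 1 ↔ ramIndex M (c + b⁻¹ : F) = 1 := by
  rw [ramIndex_coe, ramIndex_coe, ramIndexFinite_eq_one_iff, ramIndexFinite_eq_one_iff,
    rowWronskian, rowPoly_sourceChange, rowPoly_sourceChange,
    wronskian_reflect_eval_ne_zero_iff (natDegree_taylor_rowPoly_le c M 0)
      (natDegree_taylor_rowPoly_le c M 1) hb, wronskian_taylor, taylor_eval, add_comm]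
  rfl

theorem ramIndex_sourceChange_zero (hd : d ≠ 0) (c : F) (M : Matrix (Fin 2) (Fin (d + 1)) F) :
    ramIndex (sourceChange c M) (0 : F) = 1 ↔ ramIndex M OnePoint.infty = 1 := by
  have h0 := natDegree_rowPoly_le M 0
  have h1 := natDegree_rowPoly_le M 1
  rw [ramIndex_coe, ramIndex_infty, ramIndexFinite_eq_one_iff, ramIndexFinite_eq_one_iff,
    rowWronskian, rowWronskian, rowPoly_sourceChange, rowPoly_sourceChange, rowPoly_invSource,
    rowPoly_invSource, wronskian_reflect_eval_zero (natDegree_taylor_rowPoly_le c M 0)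
      (natDegree_taylor_rowPoly_le c M 1) hd, wronskian_reflect_eval_zero h0 h1 hd,
    wronskian_taylor, coeff_taylor_of_natDegree_le c (natDegree_wronskian_le h0 h1 hd)]

/-- The substitution sends `∞` to `c`, `0` to `∞`, and any other `b` to `c + 1/b`. The full index
must be tracked only at `c`; elsewhere it suffices to compare the condition of index `1`. -/
theorem mem_ramLocus_iff_sourceChange [IsAlgClosed F] {e : ℕ} (hd : d ≠ 0) (he : e ≠ 0) (c : F)
    (x : CoeffSpace F d) :
    x ∈ ramLocus d e (c : OnePoint F) ↔
      Projectivization.map (sourceChange c).toLinearMap (sourceChange c).injective x ∈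
        ramLocus d e OnePoint.infty := by
  induction x using Projectivization.ind with
  | h M hM =>
  rw [Projectivization.map_mk, mk_mem_ramLocus_iff he, mk_mem_ramLocus_iff he]
  simp only [LinearEquiv.coe_coe]
  rw [ramIndex_sourceChange_infty]
  refine and_congr_right' ⟨fun h y hy => ?_, fun h y hy => ?_⟩
  · induction y using OnePoint.rec with
    | infty => exact absurd rfl hy
    | coe b =>
      rcases eq_or_ne b 0 with rfl | hb
      · exact (ramIndex_sourceChange_zero hd c M).2 (h _ (OnePoint.infty_ne_coe _))
      · refine (ramIndex_sourceChange_coe c hb M).2 (h _ fun h0 => ?_)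
        simpa [hb] using OnePoint.coe_injective h0
  · induction y using OnePoint.rec with
    | infty => exact (ramIndex_sourceChange_zero hd c M).1 (h _ (OnePoint.coe_ne_infty _))
    | coe a =>
      have ha : a - c ≠ 0 := sub_ne_zero.2 fun h0 => hy (by rw [h0])
      have := (ramIndex_sourceChange_coe c (inv_ne_zero ha) M).1 (h _ (OnePoint.coe_ne_infty _))
      rwa [inv_inv, add_sub_cancel] at this

theorem postcomp_map_sourceChange (c : F) (σ : SL(2, F)) (x : CoeffSpace F d) :
    Projectivization.map (sourceChange c).toLinearMap (sourceChange c).injective (postcomp σ x) =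
      postcomp σ
        (Projectivization.map (sourceChange c).toLinearMap (sourceChange c).injective x) := by
  induction x using Projectivization.ind with
  | h M hM =>
  simp only [postcomp, Projectivization.map_mk]
  congr 1
  exact sourceChange_mul c _ M

/-- Precomposition with `z ↦ c + 1 / z`, on the space of coefficients. -/
noncomputable def sourceChangeHomeomorph (c : F) : CoeffSpace F d ≃ₜ CoeffSpace F d where
  toFun := Projectivization.map (sourceChange c).toLinearMap (sourceChange c).injective
  invFun := Projectivization.map (sourceChange c).symm.toLinearMap (sourceChange c).symm.injective
  left_inv x := by
    induction x using Projectivization.ind with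
    | h M hM => simp [Projectivization.map_mk]
  right_inv x := by
    induction x using Projectivization.ind with
    | h M hM => simp [Projectivization.map_mk]
  continuous_toFun := continuous_projectivizationMap _ _
  continuous_invFun := continuous_projectivizationMap _ _

/-- A homeomorphism of the coefficient spaces that commutes with postcomposition and matches the
ramification loci induces a homeomorphism of the orbit spaces. -/
noncomputable def postcompClassesCongr {e : ℕ} {c c' : OnePoint F}
    (Θ : CoeffSpace F d ≃ₜ CoeffSpace F d)
    (hmem : ∀ x, x ∈ ramLocus d e c ↔ Θ x ∈ ramLocus d e c')
    (hΘ : ∀ (σ : SL(2, F)) (x : CoeffSpace F d), Θ (postcomp σ x) = postcomp σ (Θ x)) :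
    PostcompClasses (F := F) d e c ≃ₜ PostcompClasses d e c' :=
  let Θ' : ramLocus d e c ≃ₜ ramLocus d e c' := Θ.subtype hmem
  have h : ∀ x y, (postcompSetoid d e c) x y ↔ (postcompSetoid d e c') (Θ' x) (Θ' y) :=
    fun x y => exists_congr fun σ => by
      change _ ↔ postcomp σ (Θ x) = Θ y
      rw [← hΘ, Θ.injective.eq_iff]
  { Quotient.congr Θ'.toEquiv h with
    continuous_toFun := Continuous.quotient_map' Θ'.continuous fun x y => (h x y).1
    continuous_invFun := Continuous.quotient_map' Θ'.symm.continuous fun x y hxy =>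
      (h _ _).2 (by simpa using hxy) }

theorem topologicalKrullDim_postcompClasses_coe [IsAlgClosed F] {e : ℕ} (hd : d ≠ 0) (he : e ≠ 0)
    (c : F) :
    topologicalKrullDim (PostcompClasses d e (c : OnePoint F)) =
      topologicalKrullDim (PostcompClasses (F := F) d e OnePoint.infty) :=
  IsHomeomorph.topologicalKrullDim_eq _ (postcompClassesCongr (sourceChangeHomeomorph c)
    (mem_ramLocus_iff_sourceChange hd he c) (postcomp_map_sourceChange c)).isHomeomorph

theorem ramLocus_coe_nonempty [IsAlgClosed F] {e : ℕ} (hd : d ≠ 0) (he : e ≠ 0) (c : F)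
    (h : (ramLocus (F := F) d e OnePoint.infty).Nonempty) :
    (ramLocus d e (c : OnePoint F)).Nonempty := by
  obtain ⟨x, hx⟩ := h
  obtain ⟨y, rfl⟩ := (sourceChangeHomeomorph c).surjective x
  exact ⟨y, (mem_ramLocus_iff_sourceChange hd he c y).2 hx⟩

end change_of_source

end Unicritical

namespace Unicritical

open Polynomial

/-! ### Polynomials with exponents congruent to 0 or 1 modulo p -/

section interleave

variable {R : Type*} [CommRing R]

/-- The polynomial `z ^ ε * u(z ^ p) + z ^ (1 - ε) * v(z ^ p)`. -/
noncomputable def interleave (p ε : ℕ) (u v : R[X]) : R[X] :=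
  X ^ ε * expand R p u + X ^ (1 - ε) * expand R p v

variable {p ε : ℕ}

theorem coeff_X_mul_expand_mul (hp : 2 ≤ p) (v : R[X]) (j : ℕ) :
    (X * expand R p v).coeff (p * j) = 0 := by
  rcases Nat.eq_zero_or_pos j with rfl | hj
  · simp
  · obtain ⟨i, hi⟩ : ∃ i, p * j = i + 1 := ⟨p * j - 1, by
      have := Nat.mul_pos (by lia : 0 < p) hj
      lia⟩
    rw [hi, coeff_X_mul, coeff_expand (by lia), if_neg]
    intro h
    have h2 : p ∣ i + 1 := ⟨j, hi.symm⟩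
    have := (Nat.dvd_add_right h).1 h2
    have := Nat.le_of_dvd one_pos this
    lia

theorem coeff_expand_mul_add_one (hp : 2 ≤ p) (v : R[X]) (j : ℕ) :
    (expand R p v).coeff (p * j + 1) = 0 := by
  rw [coeff_expand (by lia), if_neg]
  intro h
  have := (Nat.dvd_add_right (dvd_mul_right p j)).1 h
  have := Nat.le_of_dvd one_pos this
  lia

theorem coeff_interleave_left (hp : 2 ≤ p) (hε : ε ≤ 1) (u v : R[X]) (j : ℕ) :
    (interleave p ε u v).coeff (p * j + ε) = u.coeff j := by
  have hp0 : 0 < p := by lia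
  obtain rfl | rfl : ε = 0 ∨ ε = 1 := by lia
  · simp [interleave, coeff_X_mul_expand_mul hp, coeff_expand_mul' hp0]
  · simp [interleave, coeff_expand_mul_add_one hp, coeff_expand_mul' hp0]

theorem coeff_interleave_right (hp : 2 ≤ p) (hε : ε ≤ 1) (u v : R[X]) (j : ℕ) :
    (interleave p ε u v).coeff (p * j + (1 - ε)) = v.coeff j := by
  have h := coeff_interleave_left (ε := 1 - ε) hp (by lia) v u j
  rwa [interleave, Nat.sub_sub_self hε, add_comm] at h

/-- The exponents of the second summand are `p j + (1 - ε)`, so the total degree `p m + ε` allows `j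
≤ m - 1` for `ε = 0` and `j ≤ m` for `ε = 1`. -/
theorem natDegree_interleave_le (hp : 2 ≤ p) (hε : ε ≤ 1) {u v : R[X]} {m : ℕ}
    (hu : u.natDegree ≤ m) (hv : v.degree < (m + ε : ℕ)) :
    (interleave p ε u v).natDegree ≤ p * m + ε := by
  refine natDegree_add_le_of_degree_le ?_ ?_
  · refine natDegree_mul_le.trans ?_
    rw [natDegree_expand]
    have := natDegree_X_pow_le (R := R) ε
    have := Nat.mul_le_mul_right p hu
    lia
  · rcases eq_or_ne v 0 with rfl | hv0
    · simp
    · rw [degree_eq_natDegree hv0, Nat.cast_lt] at hv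
      refine natDegree_mul_le.trans ?_
      rw [natDegree_expand]
      have := natDegree_X_pow_le (R := R) (1 - ε)
      obtain rfl | rfl : ε = 0 ∨ ε = 1 := by lia
      · have := Nat.mul_le_mul_right p (Nat.succ_le_of_lt hv)
        rw [Nat.succ_mul] at this
        lia
      · have := Nat.mul_le_mul_right p (Nat.le_of_lt_succ hv)
        lia

theorem map_interleave {S : Type*} [CommRing S] (φ : R →+* S) (u v : R[X]) :
    (interleave p ε u v).map φ = interleave p ε (u.map φ) (v.map φ) := by
  simp [interleave, map_expand]

theorem C_mul_interleave (a : R) (u v : R[X]) :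
    C a * interleave p ε u v = interleave p ε (C a * u) (C a * v) := by
  simp only [interleave, map_mul, expand_C]
  ring

theorem wronskian_interleave [CharP R p] (hε : ε ≤ 1) (u v u' v' : R[X]) :
    wronskian (interleave p ε u v) (interleave p ε u' v') =
      C ((-1) ^ ε) * expand R p (u * v' - v * u') := by
  have hD : ∀ w : R[X], derivative (expand R p w) = 0 := fun w => by
    rw [derivative_expand, CharP.cast_eq_zero, zero_mul, mul_zero]
  obtain rfl | rfl : ε = 0 ∨ ε = 1 := by lia
  · simp only [interleave, wronskian, derivative_add, derivative_mul, hD, pow_zero, map_sub,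
      map_mul, derivative_one, Nat.sub_zero, pow_one, derivative_X, C_1]
    ring
  · simp only [interleave, wronskian, derivative_add, derivative_mul, hD, pow_zero, map_sub,
      map_mul, derivative_one, Nat.sub_self, pow_one, derivative_X, C_neg, C_1]
    ring

/-- Write `f = (f - X f') + X f'`. If `f'' = 0`, both `f'` and `f - X f'` have zero derivative, so
they are polynomials in `X ^ p`. -/
theorem exists_eq_interleave [NoZeroDivisors R] [CharP R p] (hp : p ≠ 0) (hε : ε ≤ 1) {f : R[X]}
    (hf : derivative (derivative f) = 0) : ∃ u v, f = interleave p ε u v := by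
  have h1 := expand_contract p hf hp
  have h2 := expand_contract p (f := f - X * derivative f) (by simp [hf]) hp
  obtain rfl | rfl : ε = 0 ∨ ε = 1 := by lia
  · exact ⟨contract p (f - X * derivative f), contract p (derivative f), by
      rw [interleave, h1, h2]; simp⟩
  · exact ⟨contract p (derivative f), contract p (f - X * derivative f), by
      rw [interleave, h1, h2]; simp⟩

end interleave

/-! ### Pairs with constant Wronskian -/

section constantWronskian

variable {F : Type*} [Field F]

theorem isCoprime_of_wronskian_eq_C {f g : F[X]} {κ : F} (hκ : κ ≠ 0)
    (h : wronskian f g = C κ) : IsCoprime f g :=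
  ⟨C κ⁻¹ * derivative g, -(C κ⁻¹ * derivative f), by
    have h1 : C κ⁻¹ * wronskian f g = 1 := by rw [h, ← C_mul, inv_mul_cancel₀ hκ, C_1]
    rw [← h1, wronskian]
    ring⟩

/-- Differentiating the Wronskian gives `f g'' = f'' g`. By coprimality `f` divides `f''`, which has
smaller degree unless it is zero. -/
theorem derivative_derivative_eq_zero_of_wronskian_eq_C {f g : F[X]} {κ : F} (hκ : κ ≠ 0)
    (h : wronskian f g = C κ) : derivative (derivative f) = 0 := by
  have hD : f * derivative (derivative g) = derivative (derivative f) * g := by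
    have h1 := congrArg derivative h
    simp only [wronskian, derivative_sub, derivative_mul, derivative_C] at h1
    linear_combination h1
  have hdvd : f ∣ derivative (derivative f) :=
    (isCoprime_of_wronskian_eq_C hκ h).dvd_of_dvd_mul_right ⟨_, hD.symm⟩
  by_contra hne
  have hf0 : f ≠ 0 := by
    rintro rfl
    simp at hne
  have hf1 : derivative f ≠ 0 := by
    intro h0
    simp [h0] at hne
  exact hne (eq_zero_of_dvd_of_degree_lt hdvd
    ((degree_derivative_lt hf1).trans (degree_derivative_lt hf0)))

end constantWronskian

/-! ### Monic pairs and universal Bézout coefficients -/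

section coprimePairs

variable {R : Type*} [CommRing R] {m n ε : ℕ}

/-- The coordinates for the normal forms: the lower coefficients of two monic polynomials of
degrees `m` and `n`, where the slot of the `n`-th coefficient of the first holds the determinant,
and, if `ε = 1`, one further parameter. -/
abbrev Coords (m n ε : ℕ) : Type := Fin m ⊕ Fin n ⊕ Fin ε

/-- The monic polynomial of degree `m` with given lower coefficients and vanishing `n`-th
coefficient. -/
noncomputable def upperPoly (x : Coords m n ε → R) : R[X] :=
  X ^ m + ∑ j : Fin m, monomial j (if (j : ℕ) = n then 0 else x (Sum.inl j))

/-- The monic polynomial of degree `n` with given lower coefficients. -/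
noncomputable def lowerPoly (x : Coords m n ε → R) : R[X] :=
  X ^ n + ∑ j : Fin n, monomial j (x (Sum.inr (Sum.inl j)))

/-- The parameter that exists only for `ε = 1`. -/
noncomputable def shear (x : Coords m n ε → R) : R :=
  ∑ i : Fin ε, x (Sum.inr (Sum.inr i))

theorem coeff_sum_monomial {m : ℕ} (r : Fin m → R) (j : ℕ) :
    (∑ i : Fin m, monomial (i : ℕ) (r i)).coeff j = if h : j < m then r ⟨j, h⟩ else 0 := by
  simp only [finsetSum_coeff, coeff_monomial]
  split_ifs with h
  · rw [Finset.sum_eq_single ⟨j, h⟩]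
    · simp
    · intro k _ hk
      exact if_neg fun h => hk (Fin.ext h)
    · simp
  · exact Finset.sum_eq_zero fun k _ => if_neg (by have := k.2; lia)

theorem coeff_upperPoly (x : Coords m n ε → R) (j : ℕ) : (upperPoly x).coeff j =
    if h : j < m then (if j = n then 0 else x (Sum.inl ⟨j, h⟩)) else if j = m then 1 else 0 := by
  rw [upperPoly, coeff_add, coeff_X_pow, coeff_sum_monomial]
  split_ifs <;> first | lia | simp

theorem coeff_lowerPoly (x : Coords m n ε → R) (j : ℕ) : (lowerPoly x).coeff j =
    if h : j < n then x (Sum.inr (Sum.inl ⟨j, h⟩)) else if j = n then 1 else 0 := by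
  rw [lowerPoly, coeff_add, coeff_X_pow, coeff_sum_monomial]
  split_ifs <;> first | lia | simp

theorem natDegree_upperPoly_le (x : Coords m n ε → R) : (upperPoly x).natDegree ≤ m :=
  natDegree_le_iff_coeff_eq_zero.2 fun j hj => by
    rw [coeff_upperPoly, dif_neg (by lia), if_neg (by lia)]

theorem natDegree_lowerPoly_le (x : Coords m n ε → R) : (lowerPoly x).natDegree ≤ n :=
  natDegree_le_iff_coeff_eq_zero.2 fun j hj => by
    rw [coeff_lowerPoly, dif_neg (by lia), if_neg (by lia)]

theorem natDegree_upperPoly [Nontrivial R] (x : Coords m n ε → R) : (upperPoly x).natDegree = m :=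
  (natDegree_upperPoly_le x).antisymm (le_natDegree_of_ne_zero (by simp [coeff_upperPoly]))

theorem natDegree_lowerPoly [Nontrivial R] (x : Coords m n ε → R) : (lowerPoly x).natDegree = n :=
  (natDegree_lowerPoly_le x).antisymm (le_natDegree_of_ne_zero (by simp [coeff_lowerPoly]))

theorem map_upperPoly {S : Type*} [CommRing S] (φ : R →+* S) (x : Coords m n ε → R) :
    (upperPoly x).map φ = upperPoly (fun i => φ (x i)) := by
  simp [upperPoly, Polynomial.map_sum, apply_ite φ]

theorem map_lowerPoly {S : Type*} [CommRing S] (φ : R →+* S) (x : Coords m n ε → R) :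
    (lowerPoly x).map φ = lowerPoly (fun i => φ (x i)) := by
  simp [lowerPoly, Polynomial.map_sum]

variable (R) in
/-- Universal Bézout coefficients. -/
theorem exists_bezout (hm : m ≠ 0) :
    ∃ A B : (MvPolynomial (Coords m n ε) R)[X], A.degree < n ∧ B.degree < m ∧
      upperPoly (MvPolynomial.X (R := R) (σ := Coords m n ε)) * A + lowerPoly MvPolynomial.X * B =
        C (resultant (upperPoly (MvPolynomial.X (R := R) (σ := Coords m n ε)))
          (lowerPoly MvPolynomial.X) m n) :=
  exists_mul_add_mul_eq_C_resultant _ _ (natDegree_upperPoly_le _) (natDegree_lowerPoly_le _)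
    (Or.inl hm)

end coprimePairs

end Unicritical

namespace Unicritical

open Polynomial

variable {F : Type*} [Field F] {p m n ε d : ℕ}

/-! ### The normal form of an orbit -/

section normalForm

variable (F ε) in
/-- The universal Bézout cofactor of `upperPoly`. -/
noncomputable def upperCofactor (hnm : n < m) : (MvPolynomial (Coords m n ε) F)[X] :=
  (exists_bezout (ε := ε) (n := n) F (Nat.ne_zero_of_lt hnm)).choose

variable (F ε) in
/-- The universal Bézout cofactor of `lowerPoly`. -/
noncomputable def lowerCofactor (hnm : n < m) : (MvPolynomial (Coords m n ε) F)[X] :=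
  (exists_bezout (ε := ε) (n := n) F (Nat.ne_zero_of_lt hnm)).choose_spec.choose

variable (F m n ε) in
/-- The resultant of `upperPoly` and `lowerPoly` as a polynomial in the coordinates. -/
noncomputable def universalResultant : MvPolynomial (Coords m n ε) F :=
  resultant (upperPoly MvPolynomial.X) (lowerPoly MvPolynomial.X) m n

theorem degree_map_upperCofactor_lt (hnm : n < m) (x : Coords m n ε → F) :
    ((upperCofactor F ε hnm).map (MvPolynomial.eval x)).degree < n :=
  degree_map_le.trans_lt
    (exists_bezout (ε := ε) (n := n) F (Nat.ne_zero_of_lt hnm)).choose_spec.choose_spec.1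

theorem degree_map_lowerCofactor_lt (hnm : n < m) (x : Coords m n ε → F) :
    ((lowerCofactor F ε hnm).map (MvPolynomial.eval x)).degree < m :=
  degree_map_le.trans_lt
    (exists_bezout (ε := ε) (n := n) F (Nat.ne_zero_of_lt hnm)).choose_spec.choose_spec.2.1

theorem map_upperPoly_X (x : Coords m n ε → F) :
    (upperPoly (R := MvPolynomial (Coords m n ε) F) MvPolynomial.X).map (MvPolynomial.eval x) =
      upperPoly x := by
  rw [map_upperPoly]
  simp

theorem map_lowerPoly_X (x : Coords m n ε → F) :
    (lowerPoly (R := MvPolynomial (Coords m n ε) F) MvPolynomial.X).map (MvPolynomial.eval x) =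
      lowerPoly x := by
  rw [map_lowerPoly]
  simp

theorem eval_shear_X (x : Coords m n ε → F) :
    MvPolynomial.eval x (shear MvPolynomial.X) = shear x := by
  simp [shear]

theorem eval_universalResultant (x : Coords m n ε → F) :
    MvPolynomial.eval x (universalResultant F m n ε) =
      resultant (upperPoly x) (lowerPoly x) m n := by
  rw [universalResultant, ← resultant_map_map, map_upperPoly_X, map_lowerPoly_X]

theorem eval_universalResultant_ne_zero {x : Coords m n ε → F}
    (h : IsCoprime (upperPoly x) (lowerPoly x)) :
    MvPolynomial.eval x (universalResultant F m n ε) ≠ 0 := by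
  rw [eval_universalResultant]
  have := resultant_ne_zero _ _ h
  rwa [natDegree_upperPoly, natDegree_lowerPoly] at this

theorem bezout_eval (hnm : n < m) (x : Coords m n ε → F) :
    upperPoly x * (upperCofactor F ε hnm).map (MvPolynomial.eval x) +
      lowerPoly x * (lowerCofactor F ε hnm).map (MvPolynomial.eval x) =
        C (MvPolynomial.eval x (universalResultant F m n ε)) := by
  have h := congrArg (Polynomial.map (MvPolynomial.eval x)) (exists_bezout (ε := ε) (n := n) F
    (Nat.ne_zero_of_lt hnm)).choose_spec.choose_spec.2.2
  rw [Polynomial.map_add, Polynomial.map_mul, Polynomial.map_mul, map_upperPoly_X,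
    map_lowerPoly_X, map_C] at h
  exact h

variable (F p ε) in
/-- The universal normal form: numerator and denominator of the rational function with given
coordinates, multiplied by the universal resultant. -/
noncomputable def normalRows (hnm : n < m) : Fin 2 → (MvPolynomial (Coords m n ε) F)[X] :=
  ![interleave p ε (C (universalResultant F m n ε) * upperPoly MvPolynomial.X)
      (C (MvPolynomial.X (Sum.inl ⟨n, hnm⟩)) * lowerCofactor F ε hnm +
        C (shear MvPolynomial.X * universalResultant F m n ε) * upperPoly MvPolynomial.X),
    interleave p ε (C (universalResultant F m n ε) * lowerPoly MvPolynomial.X)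
      (-(C (MvPolynomial.X (Sum.inl ⟨n, hnm⟩)) * upperCofactor F ε hnm) +
        C (shear MvPolynomial.X * universalResultant F m n ε) * lowerPoly MvPolynomial.X)]

variable (p d) in
/-- The normal form with given coordinates. -/
noncomputable def normalMatrix (hnm : n < m) (x : Coords m n ε → F) :
    Matrix (Fin 2) (Fin (d + 1)) F :=
  ofRows d fun i => (normalRows F p ε hnm i).map (MvPolynomial.eval x)

theorem degree_add_shear_mul_lt (hε : ε ≤ 1) {k : ℕ} (x : Coords m n ε → F) {a b : F} {B P : F[X]}
    (hB : B.degree < k) (hP : P.natDegree ≤ k) :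
    (C a * B + C (shear x * b) * P).degree < (k + ε : ℕ) := by
  refine degree_lt_iff_coeff_zero _ _ |>.2 fun j hj => ?_
  rw [coeff_add, coeff_C_mul, coeff_C_mul, coeff_eq_zero_of_degree_lt (n := j), mul_zero, zero_add]
  · obtain rfl | rfl : ε = 0 ∨ ε = 1 := by lia
    · simp [shear]
    · rw [coeff_eq_zero_of_natDegree_lt (by lia), mul_zero]
  · exact hB.trans_le (by exact_mod_cast (by lia : k ≤ j))

theorem map_normalRows_zero (hnm : n < m) (x : Coords m n ε → F) :
    (normalRows F p ε hnm 0).map (MvPolynomial.eval x) =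
      interleave p ε (C (MvPolynomial.eval x (universalResultant F m n ε)) * upperPoly x)
        (C (x (Sum.inl ⟨n, hnm⟩)) * (lowerCofactor F ε hnm).map (MvPolynomial.eval x) +
          C (shear x * MvPolynomial.eval x (universalResultant F m n ε)) * upperPoly x) := by
  simp [normalRows, map_interleave, map_upperPoly_X, eval_shear_X]

theorem map_normalRows_one (hnm : n < m) (x : Coords m n ε → F) :
    (normalRows F p ε hnm 1).map (MvPolynomial.eval x) =
      interleave p ε (C (MvPolynomial.eval x (universalResultant F m n ε)) * lowerPoly x)
        (C (-x (Sum.inl ⟨n, hnm⟩)) * (upperCofactor F ε hnm).map (MvPolynomial.eval x) +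
          C (shear x * MvPolynomial.eval x (universalResultant F m n ε)) * lowerPoly x) := by
  simp [normalRows, map_interleave, map_lowerPoly_X, eval_shear_X]

theorem natDegree_map_normalRows_zero_le (hp : 2 ≤ p) (hε : ε ≤ 1) (hnm : n < m)
    (x : Coords m n ε → F) :
    ((normalRows F p ε hnm 0).map (MvPolynomial.eval x)).natDegree ≤ p * m + ε := by
  rw [map_normalRows_zero]
  exact natDegree_interleave_le hp hε ((natDegree_C_mul_le _ _).trans (natDegree_upperPoly_le x))
    (degree_add_shear_mul_lt hε x (degree_map_lowerCofactor_lt hnm x) (natDegree_upperPoly_le x))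

theorem natDegree_map_normalRows_one_le (hp : 2 ≤ p) (hε : ε ≤ 1) (hnm : n < m)
    (x : Coords m n ε → F) :
    ((normalRows F p ε hnm 1).map (MvPolynomial.eval x)).natDegree ≤ p * n + ε := by
  rw [map_normalRows_one]
  exact natDegree_interleave_le hp hε ((natDegree_C_mul_le _ _).trans (natDegree_lowerPoly_le x))
    (degree_add_shear_mul_lt hε x (degree_map_upperCofactor_lt hnm x) (natDegree_lowerPoly_le x))

theorem rowPoly_normalMatrix (hp : 2 ≤ p) (hε : ε ≤ 1) (hnm : n < m) (hd : d = p * m + ε)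
    (x : Coords m n ε → F) (i : Fin 2) :
    rowPoly (normalMatrix p d hnm x) i = (normalRows F p ε hnm i).map (MvPolynomial.eval x) := by
  refine rowPoly_ofRows (fun i => ?_) i
  fin_cases i
  · exact (natDegree_map_normalRows_zero_le hp hε hnm x).trans_eq hd.symm
  · refine (natDegree_map_normalRows_one_le hp hε hnm x).trans ?_
    have := Nat.mul_le_mul_left p hnm.le
    lia

theorem rowWronskian_normalMatrix [CharP F p] (hp : 2 ≤ p) (hε : ε ≤ 1) (hnm : n < m)
    (hd : d = p * m + ε) (x : Coords m n ε → F) :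
    rowWronskian (normalMatrix p d hnm x) = C ((-1) ^ ε * -(x (Sum.inl ⟨n, hnm⟩) *
      MvPolynomial.eval x (universalResultant F m n ε) ^ 2)) := by
  rw [rowWronskian, rowPoly_normalMatrix hp hε hnm hd, rowPoly_normalMatrix hp hε hnm hd,
    map_normalRows_zero, map_normalRows_one, wronskian_interleave hε]
  refine Eq.trans (congrArg (C ((-1) ^ ε) * ·)
    (Eq.trans (congrArg (expand F p) ?_) (expand_C p _))) C_mul.symm
  -- The shear terms cancel in the determinant. The Bézout identity evaluates the rest to `-k ρ ^
  -- 2`, with `ρ` the resultant and `k` the coordinate in slot `n`.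
  have h := bezout_eval hnm x
  simp only [C_mul, C_neg, C_pow]
  linear_combination (-C (x (Sum.inl ⟨n, hnm⟩)) *
    C (MvPolynomial.eval x (universalResultant F m n ε))) * h

end normalForm

/-! ### Coordinates as ratios of minors -/

section coordinates

variable (p m n ε) in
/-- The coordinates of a class are quotients of the minors with these exponents by the minor with
exponents `p * m + ε` and `p * n + ε`. -/
def coordExponents : Coords m n ε → ℕ × ℕ
  | Sum.inl j => if (j : ℕ) = n then (1 - ε, ε) else (p * j + ε, p * n + ε)
  | Sum.inr (Sum.inl j) => (p * m + ε, p * j + ε)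
  | Sum.inr (Sum.inr _) => (p * m + (1 - ε), p * n + ε)

variable (p m n ε) in
/-- The coordinates of a coefficient matrix. -/
noncomputable def coords (M : Matrix (Fin 2) (Fin (d + 1)) F) : Coords m n ε → F := fun i =>
  minor M (coordExponents p m n ε i).1 (coordExponents p m n ε i).2 /
    minor M (p * m + ε) (p * n + ε)

theorem coords_mul {A : Matrix (Fin 2) (Fin 2) F} (hA : A.det ≠ 0)
    (M : Matrix (Fin 2) (Fin (d + 1)) F) :
    coords p m n ε (A * M) = coords p m n ε M := by
  funext i
  simp only [coords, minor_mul]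
  rw [mul_div_mul_left _ _ hA]

theorem coeff_normalMatrix_zero (hp : 2 ≤ p) (hε : ε ≤ 1) (hnm : n < m) (hd : d = p * m + ε)
    (x : Coords m n ε → F) (j : ℕ) :
    (rowPoly (normalMatrix p d hnm x) 0).coeff (p * j + ε) =
      MvPolynomial.eval x (universalResultant F m n ε) * (upperPoly x).coeff j := by
  rw [rowPoly_normalMatrix hp hε hnm hd, map_normalRows_zero, coeff_interleave_left hp hε,
    coeff_C_mul]

theorem coeff_normalMatrix_one (hp : 2 ≤ p) (hε : ε ≤ 1) (hnm : n < m) (hd : d = p * m + ε)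
    (x : Coords m n ε → F) (j : ℕ) :
    (rowPoly (normalMatrix p d hnm x) 1).coeff (p * j + ε) =
      MvPolynomial.eval x (universalResultant F m n ε) * (lowerPoly x).coeff j := by
  rw [rowPoly_normalMatrix hp hε hnm hd, map_normalRows_one, coeff_interleave_left hp hε,
    coeff_C_mul]

/-- Columns `p * m + ε` and `p * n + ε` of the normal form are `ρ` times the standard basis vectors,
with `ρ` the resultant. Minors involving one of them therefore read off the coefficients of a single
row. -/
theorem minor_normalMatrix_top (hp : 2 ≤ p) (hε : ε ≤ 1) (hnm : n < m) (hd : d = p * m + ε)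
    (x : Coords m n ε → F) (j : ℕ) :
    minor (normalMatrix p d hnm x) (p * m + ε) j =
      MvPolynomial.eval x (universalResultant F m n ε) *
        (rowPoly (normalMatrix p d hnm x) 1).coeff j := by
  rw [minor, coeff_normalMatrix_zero hp hε hnm hd, coeff_normalMatrix_one hp hε hnm hd]
  simp [coeff_upperPoly, coeff_lowerPoly, hnm.ne', hnm.not_gt]

theorem minor_normalMatrix_bottom (hp : 2 ≤ p) (hε : ε ≤ 1) (hnm : n < m) (hd : d = p * m + ε)
    (x : Coords m n ε → F) (j : ℕ) :
    minor (normalMatrix p d hnm x) j (p * n + ε) =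
      (rowPoly (normalMatrix p d hnm x) 0).coeff j *
        MvPolynomial.eval x (universalResultant F m n ε) := by
  rw [minor, coeff_normalMatrix_zero hp hε hnm hd, coeff_normalMatrix_one hp hε hnm hd]
  simp [coeff_upperPoly, coeff_lowerPoly, hnm]

theorem minor_normalMatrix (hp : 2 ≤ p) (hε : ε ≤ 1) (hnm : n < m) (hd : d = p * m + ε)
    (x : Coords m n ε → F) :
    minor (normalMatrix p d hnm x) (p * m + ε) (p * n + ε) =
      MvPolynomial.eval x (universalResultant F m n ε) ^ 2 := by
  rw [minor_normalMatrix_top hp hε hnm hd, coeff_normalMatrix_one hp hε hnm hd]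
  simp [coeff_lowerPoly, sq]

theorem minor_normalMatrix_eq_zero (hp : 2 ≤ p) (hε : ε ≤ 1) (hnm : n < m) (hd : d = p * m + ε)
    (x : Coords m n ε → F) {j : ℕ} (hj : p * n + ε < j) :
    minor (normalMatrix p d hnm x) (p * m + ε) j = 0 := by
  rw [minor_normalMatrix_top hp hε hnm hd, rowPoly_normalMatrix hp hε hnm hd,
    coeff_eq_zero_of_natDegree_lt ((natDegree_map_normalRows_one_le hp hε hnm x).trans_lt hj),
    mul_zero]

/-- This minor is the constant term of `Q P₁ - P Q₁`, which suffices because that determinant is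
constant. -/
theorem minor_normalMatrix_det (hp : 2 ≤ p) (hε : ε ≤ 1) (hnm : n < m) (hd : d = p * m + ε)
    (x : Coords m n ε → F) :
    minor (normalMatrix p d hnm x) (1 - ε) ε =
      x (Sum.inl ⟨n, hnm⟩) * MvPolynomial.eval x (universalResultant F m n ε) ^ 2 := by
  have h0 (u v : F[X]) : (interleave p ε u v).coeff ε = u.coeff 0 := by
    simpa using coeff_interleave_left hp hε u v 0
  have h1 (u v : F[X]) : (interleave p ε u v).coeff (1 - ε) = v.coeff 0 := by
    simpa using coeff_interleave_right hp hε u v 0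
  have hb := congrArg (coeff · 0) (bezout_eval hnm x)
  simp only [coeff_add, mul_coeff_zero, coeff_C_zero] at hb
  simp only [minor, rowPoly_normalMatrix hp hε hnm hd, map_normalRows_zero, map_normalRows_one,
    h0, h1, coeff_add, coeff_C_mul]
  linear_combination (x (Sum.inl ⟨n, hnm⟩) *
    MvPolynomial.eval x (universalResultant F m n ε)) * hb

theorem coords_normalMatrix (hp : 2 ≤ p) (hε : ε ≤ 1) (hnm : n < m) (hd : d = p * m + ε)
    {x : Coords m n ε → F} (hx : MvPolynomial.eval x (universalResultant F m n ε) ≠ 0) :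
    coords p m n ε (normalMatrix p d hnm x) = x := by
  funext i
  rw [coords, minor_normalMatrix hp hε hnm hd, div_eq_iff (pow_ne_zero 2 hx)]
  rcases i with j | j | j
  · simp only [coordExponents]
    split_ifs with hj
    · obtain rfl : j = ⟨n, hnm⟩ := Fin.ext hj
      exact minor_normalMatrix_det hp hε hnm hd x
    · rw [minor_normalMatrix_bottom hp hε hnm hd, coeff_normalMatrix_zero hp hε hnm hd,
        coeff_upperPoly, dif_pos j.2, if_neg hj]
      ring
  · simp only [coordExponents]
    rw [minor_normalMatrix_top hp hε hnm hd, coeff_normalMatrix_one hp hε hnm hd,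
      coeff_lowerPoly, dif_pos j.2]
    ring
  · simp only [coordExponents]
    obtain rfl : ε = 1 := by have := j.2; lia
    rw [minor_normalMatrix_bottom hp hε hnm hd, rowPoly_normalMatrix hp hε hnm hd,
      map_normalRows_zero, coeff_interleave_right hp hε, coeff_add, coeff_C_mul, coeff_C_mul,
      coeff_eq_zero_of_degree_lt (degree_map_lowerCofactor_lt hnm x), coeff_upperPoly,
      dif_neg (lt_irrefl m), if_pos rfl, shear, Fin.sum_univ_one, Subsingleton.elim j 0]
    ring

end coordinates

end Unicritical

namespace Unicritical

open Polynomial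

variable {F : Type*} [Field F] {p m n ε d : ℕ}

/-! ### Reconstructing a function from its coordinates -/

section reconstruction

/-- A pair proportional to a coprime pair `(P, P₁)` whose first entry has degree less than that of
`P` vanishes. -/
theorem eq_of_mul_eq_mul {P P₁ D D₁ : F[X]} (hP : P ≠ 0) (hcop : IsCoprime P P₁)
    (hD : D.degree < P.degree) (h : D * P₁ = P * D₁) : D = 0 ∧ D₁ = 0 := by
  have hD0 : D = 0 := eq_zero_of_dvd_of_degree_lt (hcop.dvd_of_dvd_mul_right ⟨D₁, h⟩) hD
  refine ⟨hD0, ?_⟩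
  rw [hD0, zero_mul, zero_eq_mul] at h
  exact h.resolve_left hP

theorem upperPoly_coords {M : Matrix (Fin 2) (Fin (d + 1)) F} (hp : 2 ≤ p) (hε : ε ≤ 1)
    (hd : d = p * m + ε)
    (h0 : ∀ j, (rowPoly M 0).coeff j = minor M j (p * n + ε))
    (hμ : minor M (p * m + ε) (p * n + ε) = 1)
    {u v : F[X]} (huv : rowPoly M 0 = interleave p ε u v) :
    upperPoly (coords p m n ε M) = u := by
  ext j
  have hu : u.coeff j = minor M (p * j + ε) (p * n + ε) := by
    rw [← h0, huv, coeff_interleave_left hp hε]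
  rw [coeff_upperPoly, hu]
  split_ifs with h1 h2 h3
  · rw [h2, minor, sub_self]
  · rw [coords, hμ, div_one]
    simp [coordExponents, h2]
  · rw [h3, hμ]
  · have := Nat.mul_lt_mul_of_pos_left (by lia : m < j) (by lia : 0 < p)
    rw [← h0, coeff_eq_zero_of_natDegree_lt]
    have := natDegree_rowPoly_le M 0
    lia

theorem lowerPoly_coords {M : Matrix (Fin 2) (Fin (d + 1)) F} (hp : 2 ≤ p) (hε : ε ≤ 1)
    (h1 : ∀ j, (rowPoly M 1).coeff j = minor M (p * m + ε) j)
    (hμ : minor M (p * m + ε) (p * n + ε) = 1)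
    (hvan : ∀ j, p * n + ε < j → minor M (p * m + ε) j = 0)
    {u v : F[X]} (huv : rowPoly M 1 = interleave p ε u v) :
    lowerPoly (coords p m n ε M) = u := by
  ext j
  have hu : u.coeff j = minor M (p * m + ε) (p * j + ε) := by
    rw [← h1, huv, coeff_interleave_left hp hε]
  rw [coeff_lowerPoly, hu]
  split_ifs with h2 h3
  · rw [coords, hμ, div_one]
    rfl
  · rw [h3, hμ]
  · have := Nat.mul_lt_mul_of_pos_left (by lia : n < j) (by lia : 0 < p)
    rw [hvan _ (by lia)]

theorem normalMatrix_coords_of_normalized [CharP F p] (hp : 2 ≤ p) (hε : ε ≤ 1)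
    (hnm : n < m) (hd : d = p * m + ε) {M : Matrix (Fin 2) (Fin (d + 1)) F}
    (h0 : ∀ j, (rowPoly M 0).coeff j = minor M j (p * n + ε))
    (h1 : ∀ j, (rowPoly M 1).coeff j = minor M (p * m + ε) j)
    (hμ : minor M (p * m + ε) (p * n + ε) = 1)
    (hvan : ∀ j, p * n + ε < j → minor M (p * m + ε) j = 0)
    {κ : F} (hκ : κ ≠ 0) (hW : rowWronskian M = C κ) :
    MvPolynomial.eval (coords p m n ε M) (universalResultant F m n ε) ≠ 0 ∧
      coords p m n ε M (Sum.inl ⟨n, hnm⟩) ≠ 0 ∧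
      normalMatrix p d hnm (coords p m n ε M) =
        MvPolynomial.eval (coords p m n ε M) (universalResultant F m n ε) • M := by
  have hp0 : 0 < p := by lia
  obtain ⟨P, Q, hPQ⟩ := exists_eq_interleave (p := p) hp0.ne' hε
    (derivative_derivative_eq_zero_of_wronskian_eq_C hκ hW)
  obtain ⟨P₁, Q₁, hPQ₁⟩ := exists_eq_interleave (p := p) (f := rowPoly M 1) hp0.ne' hε
    (derivative_derivative_eq_zero_of_wronskian_eq_C (f := rowPoly M 1) (g := rowPoly M 0)
      (neg_ne_zero.2 hκ) (by rw [← wronskian_neg_eq, C_neg, ← hW, rowWronskian]))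
  have hP := upperPoly_coords hp hε hd h0 hμ hPQ
  have hP₁ := lowerPoly_coords hp hε h1 hμ hvan hPQ₁
  set x := coords p m n ε M with hx
  set ρ := MvPolynomial.eval x (universalResultant F m n ε) with hρ
  set k := x (Sum.inl ⟨n, hnm⟩) with hk
  have hk' : k = Q.coeff 0 * P₁.coeff 0 - P.coeff 0 * Q₁.coeff 0 := by
    have hl (u v : F[X]) : (interleave p ε u v).coeff ε = u.coeff 0 := by
      simpa using coeff_interleave_left hp hε u v 0
    have hr (u v : F[X]) : (interleave p ε u v).coeff (1 - ε) = v.coeff 0 := by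
      simpa using coeff_interleave_right hp hε u v 0
    rw [hk, hx, coords, hμ, div_one]
    simp only [coordExponents, if_true, minor, hPQ, hPQ₁, hl, hr]
  -- The Wronskian is, up to sign, the determinant evaluated at `X ^ p`. So the determinant is
  -- constant, and its constant term is `-k`.
  have hdet : P * Q₁ - Q * P₁ = C (-k) ∧ k ≠ 0 := by
    rw [rowWronskian, hPQ, hPQ₁, wronskian_interleave hε] at hW
    have h2 : expand F p (P * Q₁ - Q * P₁) = C ((-1) ^ ε * κ) := by
      have hs : (C ((-1) ^ ε) : F[X]) * C ((-1) ^ ε) = 1 := by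
        rw [← C_mul, ← mul_pow, neg_one_mul, neg_neg, one_pow, C_1]
      rw [C_mul, ← hW, ← mul_assoc, hs, one_mul]
    rw [expand_eq_C hp0] at h2
    have h3 := congrArg (coeff · 0) h2
    simp only [coeff_sub, mul_coeff_zero, coeff_C_zero] at h3
    have h4 : (-1) ^ ε * κ = -k := by
      rw [← h3, hk']
      ring
    rw [h4] at h2
    refine ⟨h2, fun hk0 => ?_⟩
    rw [hk0, neg_zero, mul_eq_zero, or_iff_left hκ] at h4
    exact pow_ne_zero _ (neg_ne_zero.2 one_ne_zero) h4
  obtain ⟨hdet, hk0⟩ := hdet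
  have hcop : IsCoprime P P₁ := by
    refine ⟨C (-k⁻¹) * Q₁, C k⁻¹ * Q, ?_⟩
    have : (C (-k⁻¹) * C (-k) : F[X]) = 1 := by
      rw [← C_mul, neg_mul_neg, inv_mul_cancel₀ hk0, C_1]
    rw [← this, ← hdet, C_neg]
    ring
  have hρ0 : ρ ≠ 0 := eval_universalResultant_ne_zero (by rwa [hP, hP₁])
  refine ⟨hρ0, hk0, ?_⟩
  have hPdeg : P.natDegree = m := by rw [← hP, natDegree_upperPoly]
  have hP0 : P ≠ 0 := by
    rintro rfl
    rw [natDegree_zero] at hPdeg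
    lia
  have hb := bezout_eval hnm x
  -- Such a coefficient sits in `f` at exponent `p j + (1 - ε) > p m + ε = d`, using `p ≥ 2` when `ε
  -- = 1`.
  have hQ : ∀ j, m + ε ≤ j → Q.coeff j = 0 := by
    intro j hj
    rw [← coeff_interleave_right hp hε P Q, ← hPQ, coeff_eq_zero_of_natDegree_lt]
    have := natDegree_rowPoly_le M 0
    have := Nat.mul_le_mul_left p hj
    rw [Nat.mul_add] at this
    obtain rfl | rfl : ε = 0 ∨ ε = 1 := by lia
    · lia
    · lia
  -- For `ε = 1` the coefficient of degree `m` cancels, because the shear coordinate is that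
  -- coefficient of `Q` and `P` is monic.
  have hlt : (C ρ * Q - (C k * (lowerCofactor F ε hnm).map (MvPolynomial.eval x) +
      C (shear x * ρ) * P)).degree < P.degree := by
    rw [degree_eq_natDegree hP0, hPdeg, degree_lt_iff_coeff_zero]
    intro j hj
    simp only [coeff_sub, coeff_add, coeff_C_mul]
    rw [coeff_eq_zero_of_degree_lt (n := j) ((degree_map_lowerCofactor_lt hnm x).trans_le
      (by exact_mod_cast hj))]
    obtain rfl | rfl : ε = 0 ∨ ε = 1 := by lia
    · rw [hQ j (by lia)]
      simp [shear]
    · rcases hj.eq_or_lt with rfl | hj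
      · have hs : shear x = Q.coeff m := by
          rw [shear, Fin.sum_univ_one, hx, coords, hμ, div_one]
          simp only [coordExponents]
          rw [← h0, hPQ, coeff_interleave_right hp hε]
        have hPm : P.coeff m = 1 := by simp [← hP, coeff_upperPoly]
        rw [hs, hPm]
        ring
      · rw [hQ j (by lia), coeff_eq_zero_of_natDegree_lt (by lia : P.natDegree < j)]
        ring
  -- `(ρ Q, ρ Q₁)` and the Bézout solution have the same determinant against `(P, P₁)`. Their
  -- difference is proportional to `(P, P₁)`, and the degree bound makes it zero.
  obtain ⟨hD, hD₁⟩ := eq_of_mul_eq_mul (P₁ := P₁) hP0 hcop hlt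
    (D₁ := C ρ * Q₁ - (C (-k) * (upperCofactor F ε hnm).map (MvPolynomial.eval x) +
      C (shear x * ρ) * P₁)) (by
        rw [hP, hP₁] at hb
        rw [C_neg] at hdet ⊢
        linear_combination (-C ρ) * hdet - C k * hb)
  refine rowPoly_injective fun i => ?_
  rw [rowPoly_normalMatrix hp hε hnm hd, rowPoly_smul]
  fin_cases i
  · change (normalRows F p ε hnm 0).map _ = _ * rowPoly M 0
    rw [map_normalRows_zero, hPQ, C_mul_interleave, hP, ← sub_eq_zero.1 hD]
  · change (normalRows F p ε hnm 1).map _ = _ * rowPoly M 1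
    rw [map_normalRows_one, hPQ₁, C_mul_interleave, hP₁, ← sub_eq_zero.1 hD₁]

/-- Every coefficient matrix of the ramification locus is, up to a linear change of the target,
in normal form. -/
theorem exists_mul_eq_normalMatrix [CharP F p] (hp : 2 ≤ p) (hε : ε ≤ 1)
    (hnm : n < m) (hd : d = p * m + ε) {M : Matrix (Fin 2) (Fin (d + 1)) F}
    (hμ : minor M (p * m + ε) (p * n + ε) ≠ 0)
    (hvan : ∀ j, p * n + ε < j → minor M (p * m + ε) j = 0)
    {κ : F} (hκ : κ ≠ 0) (hW : rowWronskian M = C κ) :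
    MvPolynomial.eval (coords p m n ε M) (universalResultant F m n ε) ≠ 0 ∧
      coords p m n ε M (Sum.inl ⟨n, hnm⟩) ≠ 0 ∧
      ∃ A : Matrix (Fin 2) (Fin 2) F, A.det ≠ 0 ∧
        A * M = normalMatrix p d hnm (coords p m n ε M) := by
  set μ := minor M (p * m + ε) (p * n + ε) with hμdef
  -- `A` is the inverse of the submatrix on columns `p * m + ε` and `p * n + ε`, so `A * M` has the
  -- identity in these columns.
  let A : Matrix (Fin 2) (Fin 2) F := μ⁻¹ • !![(rowPoly M 1).coeff (p * n + ε),
    -(rowPoly M 0).coeff (p * n + ε); -(rowPoly M 1).coeff (p * m + ε),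
    (rowPoly M 0).coeff (p * m + ε)]
  have hA : A.det = μ⁻¹ := by
    rw [Matrix.det_smul, Matrix.det_fin_two_of]
    have : (rowPoly M 1).coeff (p * n + ε) * (rowPoly M 0).coeff (p * m + ε) -
        -(rowPoly M 0).coeff (p * n + ε) * -(rowPoly M 1).coeff (p * m + ε) = μ := by
      rw [hμdef, minor]
      ring
    rw [this, Fintype.card_fin]
    field_simp
  have hA0 : A.det ≠ 0 := hA ▸ inv_ne_zero hμ
  have key := normalMatrix_coords_of_normalized (M := A * M) (κ := A.det * κ) hp hε hnm hd
    (fun j => by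
      rw [minor_mul, hA, rowPoly_mul, minor]
      simp only [A, Matrix.smul_apply, Matrix.of_apply, Matrix.cons_val', Matrix.cons_val_zero,
        Matrix.cons_val_one, Matrix.cons_val_fin_one, coeff_add, coeff_C_mul, smul_eq_mul]
      ring)
    (fun j => by
      rw [minor_mul, hA, rowPoly_mul, minor]
      simp only [A, Matrix.smul_apply, Matrix.of_apply, Matrix.cons_val', Matrix.cons_val_zero,
        Matrix.cons_val_one, Matrix.cons_val_fin_one, coeff_add, coeff_C_mul, smul_eq_mul]
      ring)
    (by rw [minor_mul, hA, inv_mul_cancel₀ hμ])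
    (fun j hj => by rw [minor_mul, hvan j hj, mul_zero])
    (mul_ne_zero hA0 hκ) (by rw [rowWronskian_mul, hW, C_mul])
  rw [coords_mul hA0] at key
  obtain ⟨hρ, hk, hN⟩ := key
  refine ⟨hρ, hk, MvPolynomial.eval (coords p m n ε M) (universalResultant F m n ε) • A, ?_, ?_⟩
  · rw [Matrix.det_smul]
    exact mul_ne_zero (pow_ne_zero _ hρ) hA0
  · rw [Matrix.smul_mul, hN]

end reconstruction

/-! ### Continuity of the coordinates and of the normal form -/

section continuity

/-- The coefficients, extended by zero, as linear forms. -/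
noncomputable def coeffForm (d : ℕ) (i : Fin 2) (j : ℕ) : MvPolynomial (Fin 2 × Fin (d + 1)) F :=
  if h : j < d + 1 then MvPolynomial.X (i, ⟨j, h⟩) else 0

theorem isHomogeneous_coeffForm (i : Fin 2) (j : ℕ) :
    (coeffForm (F := F) d i j).IsHomogeneous 1 := by
  unfold coeffForm
  split_ifs
  · exact MvPolynomial.isHomogeneous_X _ _
  · exact MvPolynomial.isHomogeneous_zero _ _ _

theorem coeffEval_coeffForm (M : Matrix (Fin 2) (Fin (d + 1)) F) (i : Fin 2) (j : ℕ) :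
    coeffEval M (coeffForm d i j) = (rowPoly M i).coeff j := by
  unfold coeffForm
  split_ifs with h
  · rw [coeffEval, MvPolynomial.eval_X]
    exact (coeff_rowPoly M i ⟨j, h⟩).symm
  · rw [map_zero, coeff_eq_zero_of_natDegree_lt]
    have := natDegree_rowPoly_le M i
    lia

/-- The minors as quadratic forms. -/
noncomputable def minorForm (d : ℕ) (i j : ℕ) : MvPolynomial (Fin 2 × Fin (d + 1)) F :=
  coeffForm d 0 i * coeffForm d 1 j - coeffForm d 0 j * coeffForm d 1 i

theorem isHomogeneous_minorForm (i j : ℕ) : (minorForm (F := F) d i j).IsHomogeneous 2 :=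
  ((isHomogeneous_coeffForm _ _).mul (isHomogeneous_coeffForm _ _)).sub
    ((isHomogeneous_coeffForm _ _).mul (isHomogeneous_coeffForm _ _))

theorem coeffEval_minorForm (M : Matrix (Fin 2) (Fin (d + 1)) F) (i j : ℕ) :
    coeffEval M (minorForm d i j) = minor M i j := by
  simp only [minorForm, map_sub, map_mul, coeffEval_coeffForm, minor]

/-- A power of the common denominator, a quadratic form, clears the denominators and leaves a form
whose nonvanishing is open on projective space. -/
theorem exists_homogenization (G : MvPolynomial (Coords m n ε) F) :
    ∃ (s : ℕ) (H : MvPolynomial (Fin 2 × Fin (d + 1)) F), H.IsHomogeneous (2 * s) ∧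
      ∀ M : Matrix (Fin 2) (Fin (d + 1)) F, minor M (p * m + ε) (p * n + ε) ≠ 0 →
        coeffEval M H = minor M (p * m + ε) (p * n + ε) ^ s *
          MvPolynomial.eval (coords p m n ε M) G := by
  induction G using MvPolynomial.induction_on with
  | C a =>
    refine ⟨0, MvPolynomial.C a, MvPolynomial.isHomogeneous_C _ _, fun M _ => ?_⟩
    rw [pow_zero, one_mul, MvPolynomial.eval_C, coeffEval, MvPolynomial.eval_C]
  | add G G' hG hG' =>
    obtain ⟨s, H, hH, h⟩ := hG
    obtain ⟨s', H', hH', h'⟩ := hG'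
    let μ : MvPolynomial (Fin 2 × Fin (d + 1)) F := minorForm d (p * m + ε) (p * n + ε)
    refine ⟨s + s', H * μ ^ s' + H' * μ ^ s, ?_, fun M hM => ?_⟩
    · refine MvPolynomial.IsHomogeneous.add ?_ ?_
      · rw [mul_add]
        exact hH.mul ((isHomogeneous_minorForm _ _).pow s')
      · rw [add_comm s, mul_add]
        exact hH'.mul ((isHomogeneous_minorForm _ _).pow s)
    · simp only [map_add, map_mul, map_pow, h M hM, h' M hM, μ, coeffEval_minorForm]
      ring
  | mul_X G i hG =>
    obtain ⟨s, H, hH, h⟩ := hG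
    refine ⟨s + 1, H * minorForm d (coordExponents p m n ε i).1 (coordExponents p m n ε i).2,
      hH.mul (isHomogeneous_minorForm _ _), fun M hM => ?_⟩
    simp only [map_mul, h M hM, coeffEval_minorForm, MvPolynomial.eval_X]
    rw [coords]
    field_simp
    ring

theorem isOpen_eval_coords_ne_zero {U : Set (CoeffSpace F d)}
    (hU : ∀ x ∈ U, minor x.rep (p * m + ε) (p * n + ε) ≠ 0) (G : MvPolynomial (Coords m n ε) F) :
    IsOpen {x : U | MvPolynomial.eval (coords p m n ε x.1.rep) G ≠ 0} := by
  obtain ⟨s, H, hH, h⟩ := exists_homogenization (p := p) (d := d) G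
  convert (isOpen_coeffEval_ne_zero hH).preimage (continuous_subtype_val (p := (· ∈ U))) using 1
  ext x
  have hx := hU x.1 x.2
  change _ ≠ 0 ↔ coeffEval x.1.rep H ≠ 0
  rw [h _ hx, mul_ne_zero_iff, and_iff_right (pow_ne_zero s hx)]

theorem coeffEval_normalMatrix (hnm : n < m) (x : Coords m n ε → F)
    (G : MvPolynomial (Fin 2 × Fin (d + 1)) F) :
    coeffEval (normalMatrix p d hnm x) G = MvPolynomial.eval x
      (MvPolynomial.bind₁ (fun k => (normalRows F p ε hnm k.1).coeff k.2) G) := by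
  refine Eq.trans ?_ (MvPolynomial.eval₂Hom_bind₁ (RingHom.id F) _ _ G).symm
  refine congrArg (fun w => MvPolynomial.eval w G) (funext fun k => ?_)
  exact coeff_map _ _

end continuity

end Unicritical

namespace Unicritical

open Polynomial

variable {F : Type*} [Field F] {p m n ε d e : ℕ}

/-! ### The orbit space as a principal open set -/

section orbitSpace

theorem coords_rep_mk {M : Matrix (Fin 2) (Fin (d + 1)) F} (hM : M ≠ 0) :
    coords p m n ε (Projectivization.mk F M hM).rep = coords p m n ε M := by
  obtain ⟨a, ha⟩ := Projectivization.exists_smul_eq_mk_rep F M hM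
  have ha' : (Projectivization.mk F M hM).rep = ((a : F) • 1 : Matrix (Fin 2) (Fin 2) F) * M := by
    rw [Matrix.smul_mul, Matrix.one_mul]
    exact ha.symm
  rw [ha', coords_mul]
  rw [Matrix.det_smul, Matrix.det_one, mul_one]
  exact pow_ne_zero _ a.ne_zero

theorem coords_rep_postcomp (σ : SL(2, F)) (x : CoeffSpace F d) :
    coords p m n ε (postcomp σ x).rep = coords p m n ε x.rep := by
  induction x using Projectivization.ind with
  | h M hM =>
  rw [postcomp, Projectivization.map_mk, coords_rep_mk, coords_rep_mk]
  exact coords_mul (by rw [σ.det_coe]; exact one_ne_zero) M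

/-- Over an algebraically closed field, every invertible change of the target is realised by
`SL₂`. -/
theorem exists_postcomp_eq_mk [IsAlgClosed F] {A : Matrix (Fin 2) (Fin 2) F} (hA : A.det ≠ 0)
    (x : CoeffSpace F d) {N : Matrix (Fin 2) (Fin (d + 1)) F} (hN : N ≠ 0) (h : A * x.rep = N) :
    ∃ σ : SL(2, F), postcomp σ x = Projectivization.mk F N hN := by
  -- Dividing `A` by a square root of its determinant puts it in `SL₂` without changing its action
  -- on projective space.
  obtain ⟨s, hs⟩ := IsAlgClosed.exists_pow_nat_eq A.det (by decide : 0 < 2)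
  have hs0 : s ≠ 0 := by
    rintro rfl
    exact hA (by rw [← hs, zero_pow two_ne_zero])
  let σ : SL(2, F) := ⟨s⁻¹ • A, by
    rw [Matrix.det_smul, ← hs, Fintype.card_fin, ← mul_pow, inv_mul_cancel₀ hs0, one_pow]⟩
  refine ⟨σ, ?_⟩
  conv_lhs => rw [← x.mk_rep]
  rw [postcomp, Projectivization.map_mk, Projectivization.mk_eq_mk_iff']
  refine ⟨s⁻¹, ?_⟩
  rw [← h, ← Matrix.smul_mul]
  rfl

variable (F ε) in
/-- The polynomial whose nonvanishing locus is the space of coordinates. -/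
noncomputable def coordsDiscriminant (hnm : n < m) : MvPolynomial (Coords m n ε) F :=
  universalResultant F m n ε * MvPolynomial.X (Sum.inl ⟨n, hnm⟩)

theorem eval_coordsDiscriminant_ne_zero_iff (hnm : n < m) (x : Coords m n ε → F) :
    MvPolynomial.eval x (coordsDiscriminant F ε hnm) ≠ 0 ↔
      MvPolynomial.eval x (universalResultant F m n ε) ≠ 0 ∧ x (Sum.inl ⟨n, hnm⟩) ≠ 0 := by
  rw [coordsDiscriminant, map_mul, MvPolynomial.eval_X, mul_ne_zero_iff]

theorem coordsDiscriminant_ne_zero (hnm : n < m) : coordsDiscriminant F ε hnm ≠ 0 := by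
  -- The witness has `P = X ^ m`, `k = 1`, and `P₁` with constant term `1`, hence coprime to `P`.
  let x : Coords m n ε → F := fun i => Sum.elim (fun j : Fin m => if (j : ℕ) = n then 1 else 0)
    (fun _ => 1) i
  have hP : upperPoly x = X ^ m := by
    ext j
    rw [coeff_upperPoly, coeff_X_pow]
    split_ifs with h1 h2 h3 h4 <;> first | lia | simp_all [x]
  have hcop : IsCoprime (upperPoly x) (lowerPoly x) := by
    rw [hP]
    refine IsCoprime.pow_left ((irreducible_X.coprime_iff_not_dvd).2 ?_)
    rw [X_dvd_iff, coeff_lowerPoly]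
    split_ifs <;> first | lia | simp [x]
  have := (eval_coordsDiscriminant_ne_zero_iff hnm x).2
    ⟨eval_universalResultant_ne_zero hcop, by simp [x]⟩
  rintro h
  simp [h] at this

theorem normalMatrix_ne_zero (hp : 2 ≤ p) (hε : ε ≤ 1) (hnm : n < m) (hd : d = p * m + ε)
    {x : Coords m n ε → F} (hx : MvPolynomial.eval x (universalResultant F m n ε) ≠ 0) :
    normalMatrix p d hnm x ≠ 0 := by
  intro h
  have := minor_normalMatrix hp hε hnm hd x
  rw [h] at this
  refine pow_ne_zero 2 hx (this.symm.trans ?_)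
  have h0 (i : Fin 2) : rowPoly (0 : Matrix (Fin 2) (Fin (d + 1)) F) i = 0 := by simp [rowPoly]
  simp [minor, h0]

variable [IsAlgClosed F]

theorem mem_ramLocus_infty_iff (he : e ≠ 0) (hed : e ≤ d) (x : CoeffSpace F d) :
    x ∈ ramLocus d e OnePoint.infty ↔
      ((∀ j, d - e < j → minor x.rep d j = 0) ∧ minor x.rep d (d - e) ≠ 0) ∧
        ∃ κ : F, κ ≠ 0 ∧ rowWronskian x.rep = C κ := by
  conv_lhs => rw [← x.mk_rep]
  exact mk_mem_ramLocus_infty_iff he hed x.rep_nonzero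

theorem mk_normalMatrix_mem_ramLocus [CharP F p] (hp : 2 ≤ p) (hε : ε ≤ 1) (hnm : n < m)
    (hd : d = p * m + ε) (he : e ≠ 0) (hed : e ≤ d) (hde : d - e = p * n + ε)
    {x : Coords m n ε → F} (hx : MvPolynomial.eval x (coordsDiscriminant F ε hnm) ≠ 0)
    (h0 : normalMatrix p d hnm x ≠ 0) :
    Projectivization.mk F (normalMatrix p d hnm x) h0 ∈ ramLocus d e OnePoint.infty := by
  obtain ⟨hρ, hk⟩ := (eval_coordsDiscriminant_ne_zero_iff hnm x).1 hx
  rw [mk_mem_ramLocus_infty_iff he hed, hde]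
  refine ⟨⟨fun j hj => ?_, ?_⟩, _, ?_, rowWronskian_normalMatrix hp hε hnm hd x⟩
  · exact (congrArg (minor _ · j) hd).trans (minor_normalMatrix_eq_zero hp hε hnm hd x hj)
  · exact ((congrArg (minor _ · _) hd).trans (minor_normalMatrix hp hε hnm hd x)).trans_ne
      (pow_ne_zero 2 hρ)
  · exact mul_ne_zero (pow_ne_zero _ (neg_ne_zero.2 one_ne_zero))
      (neg_ne_zero.2 (mul_ne_zero hk (pow_ne_zero 2 hρ)))

theorem exists_rep_eq_normalMatrix [CharP F p] (hp : 2 ≤ p) (hε : ε ≤ 1) (hnm : n < m)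
    (hd : d = p * m + ε) (he : e ≠ 0) (hed : e ≤ d) (hde : d - e = p * n + ε)
    {x : CoeffSpace F d} (hx : x ∈ ramLocus d e OnePoint.infty) :
    minor x.rep (p * m + ε) (p * n + ε) ≠ 0 ∧
    MvPolynomial.eval (coords p m n ε x.rep) (coordsDiscriminant F ε hnm) ≠ 0 ∧
      ∃ A : Matrix (Fin 2) (Fin 2) F, A.det ≠ 0 ∧
        A * x.rep = normalMatrix p d hnm (coords p m n ε x.rep) := by
  obtain ⟨⟨hvan, hμ⟩, κ, hκ, hW⟩ := (mem_ramLocus_infty_iff he hed x).1 hx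
  rw [hde] at hvan hμ
  have hμ' : minor x.rep (p * m + ε) (p * n + ε) ≠ 0 := fun h =>
    hμ ((congrArg (minor _ · _) hd).trans h)
  obtain ⟨h1, h2, h3⟩ := exists_mul_eq_normalMatrix hp hε hnm hd hμ'
    (fun j hj => (congrArg (minor _ · j) hd).symm.trans (hvan j hj)) hκ hW
  exact ⟨hμ', (eval_coordsDiscriminant_ne_zero_iff hnm _).2 ⟨h1, h2⟩, h3⟩

/-- The orbit space of the rational functions ramified at `∞` only is a principal open subset of
an affine space. -/
noncomputable def postcompClassesHomeomorph [CharP F p] (hp : 2 ≤ p) (hε : ε ≤ 1) (hnm : n < m)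
    (hd : d = p * m + ε) (he : e ≠ 0) (hed : e ≤ d) (hde : d - e = p * n + ε) :
    PostcompClasses (F := F) d e OnePoint.infty ≃ₜ
      {x : AffinePoints F (Coords m n ε) // x.eval (coordsDiscriminant F ε hnm) ≠ 0} where
  toFun := Quotient.lift
    (fun x : ramLocus (F := F) d e OnePoint.infty => ⟨coords p m n ε x.1.rep,
      (exists_rep_eq_normalMatrix hp hε hnm hd he hed hde x.2).2.1⟩) (by
        rintro x y ⟨σ, h⟩
        refine Subtype.ext ?_
        change coords p m n ε x.1.rep = coords p m n ε y.1.rep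
        rw [← h, coords_rep_postcomp])
  invFun x := Quotient.mk _ ⟨Projectivization.mk F (normalMatrix p d hnm x.1)
      (normalMatrix_ne_zero hp hε hnm hd
        ((eval_coordsDiscriminant_ne_zero_iff hnm x.1).1 x.2).1),
    mk_normalMatrix_mem_ramLocus hp hε hnm hd he hed hde x.2 _⟩
  left_inv := by
    refine Quotient.ind fun x => (Quotient.sound ?_)
    obtain ⟨-, h, A, hA, hAx⟩ := exists_rep_eq_normalMatrix hp hε hnm hd he hed hde x.2
    refine (postcompSetoid d e OnePoint.infty).symm ?_
    exact exists_postcomp_eq_mk hA x.1 _ hAx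
  right_inv x := by
    refine Subtype.ext ?_
    change coords p m n ε (Projectivization.mk F (normalMatrix p d hnm x.1) _).rep = x.1
    rw [coords_rep_mk]
    exact coords_normalMatrix hp hε hnm hd
      ((eval_coordsDiscriminant_ne_zero_iff hnm x.1).1 x.2).1
  continuous_toFun := by
    refine Continuous.quotient_lift ?_ _
    refine Continuous.subtype_mk (AffinePoints.continuous_iff.2 fun G => ?_) _
    exact isOpen_eval_coords_ne_zero
      (fun x hx => (exists_rep_eq_normalMatrix hp hε hnm hd he hed hde hx).1) G
  continuous_invFun := by
    refine continuous_quotient_mk'.comp (Continuous.subtype_mk (continuous_mk _ fun G k _ => ?_) _)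
    convert (AffinePoints.isOpen_ne (MvPolynomial.bind₁
      (fun k => (normalRows F p ε hnm k.1).coeff k.2) G)).preimage continuous_subtype_val using 1
    ext x
    exact not_congr (Eq.congr (coeffEval_normalMatrix hnm x.1 G) rfl)

theorem topologicalKrullDim_postcompClasses_and_nonempty [CharP F p] (hp : 2 ≤ p) (hε : ε ≤ 1)
    (hnm : n < m) (hd : d = p * m + ε) (he : e ≠ 0) (hed : e ≤ d) (hde : d - e = p * n + ε)
    (c : OnePoint F) :
    topologicalKrullDim (PostcompClasses d e c) = ((m + n + ε : ℕ) : WithBot ℕ∞) ∧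
      (ramLocus d e c).Nonempty := by
  have : Infinite F := IsAlgClosed.instInfinite
  have hd0 : d ≠ 0 := by lia
  have hdisc : coordsDiscriminant F ε hnm ≠ 0 := coordsDiscriminant_ne_zero hnm
  have hdim : topologicalKrullDim (PostcompClasses (F := F) d e OnePoint.infty) =
      ((m + n + ε : ℕ) : WithBot ℕ∞) := by
    rw [AffinePoints.topologicalKrullDim_eq_card hdisc
      (postcompClassesHomeomorph hp hε hnm hd he hed hde)]
    simp [Coords, add_assoc]
  have hne : (ramLocus (F := F) d e OnePoint.infty).Nonempty := by
    obtain ⟨x, hx⟩ := AffinePoints.exists_eval_ne_zero hdisc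
    exact ⟨_, mk_normalMatrix_mem_ramLocus hp hε hnm hd he hed hde hx
      (normalMatrix_ne_zero hp hε hnm hd
        ((eval_coordsDiscriminant_ne_zero_iff hnm x).1 hx).1)⟩
  induction c using OnePoint.rec with
  | infty => exact ⟨hdim, hne⟩
  | coe a =>
    exact ⟨(topologicalKrullDim_postcompClasses_coe hd0 he a).trans hdim,
      ramLocus_coe_nonempty hd0 he a hne⟩

end orbitSpace

end Unicritical

/-! ### The two congruence classes of the degree -/

theorem theorem1p5 {F : Type*} [Field F] [IsAlgClosed F] (p : ℕ) (hp : p.Prime) [CharP F p]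
    (d e : ℕ) (hd : 1 < d) (he : 1 < e) (hdp : d ≡ 0 [MOD p] ∨ d ≡ 1 [MOD p])
    (hpe : p ∣ e) (hed : e ≤ d) (c : OnePoint F) :
    (p ∣ d → topologicalKrullDim (Unicritical.PostcompClasses d e c)
        = (((2 * d - e) / p : ℕ) : WithBot ℕ∞)) ∧
    (p ∣ d - 1 → topologicalKrullDim (Unicritical.PostcompClasses d e c)
        = ((1 + (2 * d - 2 - e) / p : ℕ) : WithBot ℕ∞)) ∧
    (Unicritical.ramLocus d e c).Nonempty := by
  have hp2 := hp.two_le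
  obtain ⟨k, rfl⟩ := hpe
  have hk : 0 < k := Nat.pos_of_ne_zero (by rintro rfl; lia)
  have h0 : p ∣ d → topologicalKrullDim (Unicritical.PostcompClasses d (p * k) c)
        = (((2 * d - p * k) / p : ℕ) : WithBot ℕ∞) ∧
      (Unicritical.ramLocus d (p * k) c).Nonempty := by
    rintro ⟨m, rfl⟩
    have hkm : k ≤ m := Nat.le_of_mul_le_mul_left hed (by lia)
    have h := Unicritical.topologicalKrullDim_postcompClasses_and_nonempty (F := F) (p := p)
      (m := m) (n := m - k) (ε := 0) (d := p * m) (e := p * k) hp2 zero_le_one (by lia) rfl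
      (by lia) hed (by rw [Nat.mul_sub, add_zero]) c
    have hdim : (2 * (p * m) - p * k) / p = m + (m - k) + 0 := by
      rw [Nat.mul_left_comm, ← Nat.mul_sub, Nat.mul_div_cancel_left _ (by lia)]
      lia
    rwa [hdim]
  have h1 : p ∣ d - 1 → topologicalKrullDim (Unicritical.PostcompClasses d (p * k) c)
        = ((1 + (2 * d - 2 - p * k) / p : ℕ) : WithBot ℕ∞) ∧
      (Unicritical.ramLocus d (p * k) c).Nonempty := by
    rintro ⟨m, hm⟩
    obtain rfl : d = p * m + 1 := by lia
    -- From `p * k ≤ p * m + 1` and `p ≥ 2`.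
    have hkm : k ≤ m := by
      by_contra! hlt
      have := Nat.mul_le_mul_left p (Nat.succ_le_of_lt hlt)
      rw [Nat.mul_succ] at this
      lia
    have hmk := Nat.mul_le_mul_left p hkm
    have h := Unicritical.topologicalKrullDim_postcompClasses_and_nonempty (F := F) (p := p)
      (m := m) (n := m - k) (ε := 1) (d := p * m + 1) (e := p * k) hp2 le_rfl (by lia) rfl
      (by lia) hed (by rw [Nat.mul_sub]; lia) c
    have hdim : 1 + (2 * (p * m + 1) - 2 - p * k) / p = m + (m - k) + 1 := by
      rw [show 2 * (p * m + 1) - 2 - p * k = p * (2 * m - k) by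
        rw [Nat.mul_sub, Nat.mul_left_comm]; lia, Nat.mul_div_cancel_left _ (by lia)]
      lia
    rwa [hdim]
  refine ⟨fun h => (h0 h).1, fun h => (h1 h).1, ?_⟩
  rcases hdp with h | h
  · exact (h0 ((Nat.modEq_zero_iff_dvd).1 h)).2
  · exact (h1 ((Nat.modEq_iff_dvd' hd.le).1 h.symm)).2
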